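/- Let $\Phi=\{x_i\}$ be a homogeneous Poisson point process on $\mathbb{R}^2$ with intensity $\lambda>0$, let $\alpha>2$ and $0<\phi\le 2\pi$, and let the channel gains $h_i>0$ be i.i.d. copies of a random variable $h$, independent of $\Phi$, with $\mathbb{E}[h^{2/\alpha}]<\infty$. For a receiver at $x\in\mathbb{R}^2$ with reception angle $\phi$, the interferers are the nodes $x_i$ for which the angle in $[0,2\pi)$ of the vector $x_i-x$ with respect to the horizontal axis is at most $\phi$. Let $z_1\le z_2\le\cdots$ be the numbers $\|x_i-x\|^{\alpha}/h_i$ (the inverses of the received interference powers), taken over all interferers and arranged in ascending order; almost surely this arrangement exists and is strictly increasing. Then for every $n\ge 1$ the partial accumulative interference $$\mathcal{I}(n)=\sum_{k=n+1}^{\infty}\frac1{z_k}$$ (the total interference of all but the $n$ dominant interferers) converges almost surely, and its conditional Laplace transform given $z_n$ is, almost surely, for all $s>0$, $$\mathbb{E}\left[e^{-s\,\mathcal{I}(n)}\,\middle|\,z_n\right]=\exp\left\{\frac{\phi\lambda}{\alpha}\,\mathbb{E}\left[h^{2/\alpha}\right]q_{z_n}(s)\right\},\qquad q_{z_n}(s)=s^{2/\alpha}\,\gamma\left(-\frac{2}{\alpha},\frac{s}{z_n}\right)+\frac{\alpha}{2}\,z_n^{2/\alpha},$$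 where $\gamma(a,y)=\Gamma(a)-\int_y^{\infty}t^{a-1}e^{-t}\,dt$ is the lower incomplete gamma function, continued analytically in $a$ to $a\in(-1,0)$. -/

import Mathlib

open MeasureTheory ProbabilityTheory Set
open scoped ENNReal

noncomputable section

namespace PoissonNetwork

/-- The Euclidean plane. -/
abbrev Plane : Type := EuclideanSpace ℝ (Fin 2)

/-- The sequence of random points `X 0, X 1, …` of `E` is (an enumeration of) a Poisson point
process with intensity measure `Λ`: the number of points in a measurable set `A` of finite
intensity is Poisson distributed with mean `Λ A`, and the numbers of points in pairwise disjoint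
measurable sets are independent. -/
structure IsPoissonPointProcess {Ω E : Type*} [MeasurableSpace Ω] [MeasurableSpace E]
    (P : Measure Ω) (Λ : Measure E) (X : ℕ → Ω → E) : Prop where
  measurable : ∀ i, Measurable (X i)
  poisson_count : ∀ A : Set E, MeasurableSet A → Λ A ≠ ∞ →
    P.map (fun ω => {i : ℕ | X i ω ∈ A}.encard) =
      (poissonMeasure (Λ A).toNNReal).map (fun k : ℕ => (k : ℕ∞))
  indep_count : ∀ (m : ℕ) (A : Fin m → Set E), (∀ j, MeasurableSet (A j)) →
    Pairwise (fun j k => Disjoint (A j) (A k)) →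
    iIndepFun (fun j ω => {i : ℕ | X i ω ∈ A j}.encard) P

/-- The angle in `[0, 2π)` between the vector `v` and the (positive) horizontal axis. -/
def polarAngle (v : Plane) : ℝ :=
  toIcoMod Real.two_pi_pos 0 (Complex.arg ⟨v 0, v 1⟩)

section Network

variable {Ω : Type*} (x : Plane) (φ α : ℝ) (X : ℕ → Ω → Plane) (h : ℕ → Ω → ℝ)

/-- The (indices of the) interferers of the receiver at `x`: the nodes seen from `x` within the
reception angle `φ`. -/
def interferers (ω : Ω) : Set ℕ :=
  {i | polarAngle (X i ω - x) ≤ φ}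

/-- The inverse received power `‖Xᵢ - x‖ ^ α / hᵢ` of node `i` at the receiver `x`. -/
def inversePower (i : ℕ) (ω : Ω) : ℝ :=
  ‖X i ω - x‖ ^ α / h i ω

/-- The point process, on the power axis, of the inverse powers of all interferers. -/
def powerPoints (ω : Ω) : Set ℝ :=
  (fun i => inversePower x α X h i ω) '' interferers x φ X ω

/-- `z n`, the `n`-th smallest inverse power (`n = 1, 2, …`): the least level `t` such that at
least `n` interferers have inverse power at most `t`. -/
def z (n : ℕ) (ω : Ω) : ℝ :=
  sInf {t : ℝ | (n : ℕ∞) ≤ {i ∈ interferers x φ X ω | inversePower x α X h i ω ≤ t}.encard}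

/-- The partial accumulative interference `∑_{k > n} 1 / z k`, which leaves out the `n` dominant
interferers. -/
def partialInterference (n : ℕ) (ω : Ω) : ℝ :=
  ∑' k : ℕ, (z x φ α X h (n + 1 + k) ω)⁻¹

end Network

/-- The lower incomplete gamma function `γ(a, y)` for `y > 0` and real `a ≠ 0, -1, -2, …`, that is
`Γ(a) - ∫_y^∞ t^(a-1) e^(-t) dt`. For `a > 0` this is `∫_0^y t^(a-1) e^(-t) dt`; for other `a` it
is the analytic continuation in `a` (`Real.Gamma` is the continued gamma function). -/
def lowerGamma (a y : ℝ) : ℝ :=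
  Real.Gamma a - ∫ t in Ioi y, t ^ (a - 1) * Real.exp (-t)

/-- `q_t(s) = s^(2/α) γ(-2/α, s/t) + (α/2) t^(2/α)`. -/
def q (α t s : ℝ) : ℝ :=
  s ^ (2 / α) * lowerGamma (-(2 / α)) (s / t) + α / 2 * t ^ (2 / α)

end PoissonNetwork

end

/-!
The marked points `(Xᵢ, hᵢ)` form a Poisson process with intensity `lam dx ⊗ ν`, and the inverse
powers are the images of those in the sector under `(y, t) ↦ ‖y - x‖ ^ α / t`. By the mapping
theorem they form a Poisson process on `(0, ∞)`, with intensity `κ y ^ (2 / α - 1) dy` where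
`κ = φ lam / α * E[h ^ (2 / α)]`. The variable `z n` is a stopping time for the filtration of the
points in `(-∞, t]`, so by the strong Markov property the points beyond `z n` are, given `z n`,
again Poisson with the same intensity. The Laplace functional of a Poisson process then gives
`exp (-κ * ∫_{z n}^∞ (1 - e^(-s/y)) y ^ (2 / α - 1) dy)` for the conditional Laplace transform, and
the integral equals `-q α (z n) s` because both sides vanish at infinity and have the same
derivative in `z n`.
-/

noncomputable section

namespace PoissonNetwork

open Filter Topology

variable {Ω E F : Type*} [MeasurableSpace Ω] [MeasurableSpace E] [MeasurableSpace F]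

/-- The decreasing exponential `x ↦ e^(-x)` on `[0, ∞]`, with `e^(-∞) = 0`; it is the kernel of
all Laplace transforms below. -/
def expNeg (x : ℝ≥0∞) : ℝ≥0∞ := EReal.exp (-(x : EReal))

@[simp] lemma expNeg_zero : expNeg 0 = 1 := by simp [expNeg]

@[simp] lemma expNeg_top : expNeg ∞ = 0 := by simp [expNeg]

lemma expNeg_add (x y : ℝ≥0∞) : expNeg (x + y) = expNeg x * expNeg y := by
  rw [expNeg, EReal.coe_ennreal_add, EReal.neg_add, sub_eq_add_neg, EReal.exp_add]
  · rfl
  · exact Or.inl (EReal.coe_ennreal_ne_bot x)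
  · exact Or.inr (EReal.coe_ennreal_ne_bot y)

lemma strictAnti_expNeg : StrictAnti expNeg := fun x y h => by simpa [expNeg] using h

lemma continuous_expNeg : Continuous expNeg :=
  ENNReal.continuous_exp.comp (continuous_neg.comp continuous_coe_ennreal_ereal)

@[fun_prop]
lemma measurable_expNeg : Measurable expNeg := continuous_expNeg.measurable

lemma expNeg_le_one (x : ℝ≥0∞) : expNeg x ≤ 1 := by
  simpa using strictAnti_expNeg.antitone (zero_le (a := x))

lemma expNeg_ne_top (x : ℝ≥0∞) : expNeg x ≠ ∞ :=
  ne_top_of_le_ne_top ENNReal.one_ne_top (expNeg_le_one x)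

lemma expNeg_ofReal {r : ℝ} (hr : 0 ≤ r) :
    expNeg (ENNReal.ofReal r) = ENNReal.ofReal (Real.exp (-r)) := by
  rw [expNeg, EReal.coe_ennreal_ofReal, max_eq_left hr, ← EReal.coe_neg, EReal.exp_coe]

lemma lintegral_one_sub_expNeg_le (μ : Measure E) (f : E → ℝ≥0∞) :
    ∫⁻ x, 1 - expNeg (f x) ∂μ ≤ μ univ :=
  (lintegral_mono fun _ => tsub_le_self).trans_eq (by simp)

lemma expNeg_sum {ι : Type*} (s : Finset ι) (a : ι → ℝ≥0∞) :
    expNeg (∑ i ∈ s, a i) = ∏ i ∈ s, expNeg (a i) := by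
  classical
  induction s using Finset.induction_on with
  | empty => simp
  | insert i s hi ih => rw [Finset.sum_insert hi, Finset.prod_insert hi, expNeg_add, ih]

lemma expNeg_nat_mul (n : ℕ) (x : ℝ≥0∞) : expNeg (n * x) = expNeg x ^ n := by
  simpa using expNeg_sum (Finset.range n) (fun _ => x)

lemma tendsto_expNeg_inv_mul {x : ℝ≥0∞} (hx : x ≠ ∞) :
    Tendsto (fun k : ℕ => expNeg (((k + 1 : ℕ) : ℝ≥0∞)⁻¹ * x)) atTop (𝓝 1) := by
  have hmul : Tendsto (fun k : ℕ => ((k + 1 : ℕ) : ℝ≥0∞)⁻¹ * x) atTop (𝓝 (0 * x)) :=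
    ENNReal.Tendsto.mul_const ((tendsto_add_atTop_iff_nat 1).2
      ENNReal.tendsto_inv_nat_nhds_zero) (Or.inr hx)
  simpa [Function.comp_def] using (continuous_expNeg.tendsto _).comp hmul

/-- The inverse of `expNeg` on `[0, 1]`. -/
def negLog (u : ℝ≥0∞) : ℝ≥0∞ := (-ENNReal.log u).toENNReal

@[fun_prop]
lemma measurable_negLog : Measurable negLog := by
  unfold negLog
  fun_prop

lemma expNeg_negLog {u : ℝ≥0∞} (hu : u ≤ 1) : expNeg (negLog u) = u := by
  have hlog : 0 ≤ -ENNReal.log u := by simpa using hu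
  rw [expNeg, negLog, EReal.coe_toENNReal hlog, neg_neg, ENNReal.exp_log]

section LaplaceUniqueness

lemma integral_expNeg_toReal_pow {μ : Measure ℝ≥0∞} (k : ℕ) :
    ∫ x, (expNeg x).toReal ^ k ∂μ = (∫⁻ x, expNeg (k * x) ∂μ).toReal := by
  simp_rw [expNeg_nat_mul, ← ENNReal.toReal_pow]
  exact integral_toReal (by fun_prop)
    (ae_of_all _ fun x => ENNReal.pow_lt_top (expNeg_ne_top x).lt_top)

/-- The function `expNeg` as a bounded continuous real-valued function, the generator of the
algebra to which the Stone-Weierstrass uniqueness theorem is applied. -/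
def expNegBCF : BoundedContinuousFunction ℝ≥0∞ ℝ :=
  .ofNormedAddCommGroup (fun x => (expNeg x).toReal)
    (ENNReal.continuousOn_toReal.comp_continuous continuous_expNeg expNeg_ne_top) 1 fun x => by
      simpa [abs_of_nonneg] using ENNReal.toReal_mono ENNReal.one_ne_top (expNeg_le_one x)

/-- The powers of `e^(-x)` span an algebra that separates points. -/
lemma ext_of_lintegral_expNeg_nat_mul {μ ν : Measure ℝ≥0∞} [IsFiniteMeasure μ] [IsFiniteMeasure ν]
    (h : ∀ k : ℕ, ∫⁻ x, expNeg (k * x) ∂μ = ∫⁻ x, expNeg (k * x) ∂ν) : μ = ν := by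
  let A : StarSubalgebra ℝ (BoundedContinuousFunction ℝ≥0∞ ℝ) :=
    { Algebra.adjoin ℝ {expNegBCF} with
      star_mem' := fun {f} hf => by
        rwa [show star f = f from BoundedContinuousFunction.ext fun x => star_trivial _] }
  refine ext_of_forall_mem_subalgebra_integral_eq_of_polish (A := A) (fun x y hxy => ?_)
    fun g hg => ?_
  · refine ⟨_, ⟨_, StarSubalgebra.mem_map.2 ⟨expNegBCF, Algebra.self_mem_adjoin_singleton ℝ _,
      rfl⟩, rfl⟩, fun hxy' => hxy (strictAnti_expNeg.injective ?_)⟩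
    exact (ENNReal.toReal_eq_toReal_iff' (expNeg_ne_top x) (expNeg_ne_top y)).1 hxy'
  · replace hg : g ∈ Submodule.span ℝ (Submonoid.closure {expNegBCF} : Set _) := by
      rwa [← Algebra.adjoin_eq_span]
    induction hg using Submodule.span_induction with
    | mem g hg =>
      obtain ⟨k, rfl⟩ := Submonoid.mem_closure_singleton.1 hg
      have key := congrArg ENNReal.toReal (h k)
      rwa [← integral_expNeg_toReal_pow, ← integral_expNeg_toReal_pow] at key
    | zero => simp
    | add f g _ _ hf hg =>
      simp only [BoundedContinuousFunction.coe_add, Pi.add_apply]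
      rw [integral_add (f.integrable _) (g.integrable _), hf, hg,
        integral_add (f.integrable _) (g.integrable _)]
    | smul c f _ hf => simp [integral_const_mul, hf]

lemma indepFun_of_lintegral_expNeg_mul {Ω : Type*} [MeasurableSpace Ω] {P : Measure Ω}
    [IsProbabilityMeasure P] {U V : Ω → ℝ≥0∞} (hU : Measurable U) (hV : Measurable V)
    (h : ∀ k l : ℕ, ∫⁻ ω, expNeg (k * U ω) * expNeg (l * V ω) ∂P =
      (∫⁻ ω, expNeg (k * U ω) ∂P) * ∫⁻ ω, expNeg (l * V ω) ∂P) : IndepFun U V P := by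
  have hfinite (l : ℕ) : IsFiniteMeasure (P.withDensity fun ω => expNeg (l * V ω)) :=
    isFiniteMeasure_withDensity (ne_top_of_le_ne_top (by simp : ∫⁻ _, 1 ∂P ≠ ∞)
      (lintegral_mono fun ω => expNeg_le_one _))
  have hconst (l : ℕ) : ∫⁻ ω, expNeg (l * V ω) ∂P ≠ ∞ := by
    simpa using (hfinite l).measure_univ_lt_top.ne
  have weighted (l : ℕ) : (P.withDensity fun ω => expNeg (l * V ω)).map U =
      (∫⁻ ω, expNeg (l * V ω) ∂P) • P.map U := by
    have := (P.map U).smul_finite (hconst l)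
    refine ext_of_lintegral_expNeg_nat_mul fun k => ?_
    rw [lintegral_map (by fun_prop) hU, lintegral_smul_measure, lintegral_map (by fun_prop) hU,
      lintegral_withDensity_eq_lintegral_mul _ (by fun_prop) (by fun_prop), smul_eq_mul,
      mul_comm _ (∫⁻ ω, expNeg (k * U ω) ∂P), ← h k l]
    exact lintegral_congr fun ω => mul_comm _ _
  refine indepFun_iff_measure_inter_preimage_eq_mul.2 fun A B hA hB => ?_
  have restricted : (P.restrict (U ⁻¹' A)).map V = P (U ⁻¹' A) • P.map V := by
    have := (P.map V).smul_finite (measure_ne_top P (U ⁻¹' A))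
    refine ext_of_lintegral_expNeg_nat_mul fun l => ?_
    have key := congrArg (· A) (weighted l)
    simp only [Measure.map_apply hU hA, withDensity_apply _ (hU hA), Measure.smul_apply,
      smul_eq_mul] at key
    rw [lintegral_map (by fun_prop) hV, key, lintegral_smul_measure,
      lintegral_map (by fun_prop) hV, smul_eq_mul, mul_comm]
  have key := congrArg (· B) restricted
  simpa [Measure.map_apply hV hB, Measure.restrict_apply (hV hB), inter_comm] using key

end LaplaceUniqueness

section PoissonLaw

lemma lintegral_expNeg_mul_poissonMeasure (r : NNReal) (c : ℝ≥0∞) :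
    ∫⁻ k : ℕ, expNeg (k * c) ∂(poissonMeasure r) = expNeg ((1 - expNeg c) * r) := by
  obtain ⟨v, hv⟩ : ∃ v : NNReal, expNeg c = v := ⟨_, (ENNReal.coe_toNNReal (expNeg_ne_top c)).symm⟩
  have hv1 : (v : ℝ) ≤ 1 := by exact_mod_cast hv ▸ expNeg_le_one c
  have hterm (n : ℕ) : ENNReal.ofReal (Real.exp (-r) * r ^ n / n.factorial) * (v : ℝ≥0∞) ^ n =
      ENNReal.ofReal (Real.exp (-r) * ((r * v : ℝ) ^ n / n.factorial)) := by
    rw [← ENNReal.ofReal_coe_nnreal, ← ENNReal.ofReal_pow (NNReal.coe_nonneg v),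
      ← ENNReal.ofReal_mul (by positivity)]
    congr 1
    ring
  have hsum : HasSum (fun n : ℕ => Real.exp (-r) * ((r * v : ℝ) ^ n / n.factorial))
      (Real.exp (-r) * Real.exp (r * v)) := by
    simpa only [← Real.exp_eq_exp_ℝ] using
      (NormedSpace.expSeries_div_hasSum_exp (r * v : ℝ)).mul_left (Real.exp (-r))
  have hexponent : (1 - (v : ℝ≥0∞)) * r = ENNReal.ofReal ((1 - v) * r) := by
    rw [ENNReal.ofReal_mul (by linarith), ENNReal.ofReal_sub _ (NNReal.coe_nonneg v),
      ENNReal.ofReal_one, ENNReal.ofReal_coe_nnreal, ENNReal.ofReal_coe_nnreal]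
  rw [poissonMeasure, lintegral_sum_measure]
  simp_rw [lintegral_smul_measure, lintegral_dirac, expNeg_nat_mul, hv, smul_eq_mul, hterm]
  rw [← ENNReal.ofReal_tsum_of_nonneg (fun n => by positivity) hsum.summable, hsum.tsum_eq,
    hexponent, expNeg_ofReal (mul_nonneg (by linarith) (NNReal.coe_nonneg r)), ← Real.exp_add]
  ring_nf

lemma poissonMeasure_Ioi_one_le (r : NNReal) : poissonMeasure r (Ioi 1) ≤ (r : ℝ≥0∞) ^ 2 := by
  have hcompl : (Ioi 1 : Set ℕ)ᶜ = {0} ∪ {1} := by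
    ext k
    simp only [compl_Ioi, mem_Iic, union_singleton, mem_insert_iff, mem_singleton_iff]
    lia
  have hreal : (poissonMeasure r).real (Ioi 1) = 1 - (Real.exp (-r) + Real.exp (-r) * r) := by
    rw [← compl_compl (Ioi 1), probReal_compl_eq_one_sub .of_discrete, hcompl,
      measureReal_union (by simp) .of_discrete, poissonMeasure_real_singleton,
      poissonMeasure_real_singleton]
    simp
  rw [← ofReal_measureReal, hreal, ← ENNReal.ofReal_coe_nnreal,
    ← ENNReal.ofReal_pow (NNReal.coe_nonneg r)]
  refine ENNReal.ofReal_le_ofReal ?_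
  nlinarith [Real.add_one_le_exp (-(r : ℝ)), NNReal.coe_nonneg r]

end PoissonLaw

/-- The random measure `N` is a Poisson random measure with intensity `Λ`, characterized by its
Laplace functional `E[exp(-∫ f dN)] = exp(-∫ (1 - e^(-f)) dΛ)`. -/
structure IsPoissonRandomMeasure (P : Measure Ω) (Λ : Measure E) (N : Ω → Measure E) :
    Prop where
  measurable : Measurable N
  lintegral_expNeg_lintegral : ∀ f : E → ℝ≥0∞, Measurable f →
    ∫⁻ ω, expNeg (∫⁻ x, f x ∂N ω) ∂P = expNeg (∫⁻ x, 1 - expNeg (f x) ∂Λ)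

namespace IsPoissonRandomMeasure

variable {P : Measure Ω} {Λ : Measure E} {N : Ω → Measure E}

lemma measurable_apply (hN : IsPoissonRandomMeasure P Λ N) {B : Set E} (hB : MeasurableSet B) :
    Measurable fun ω => N ω B :=
  (Measure.measurable_coe hB).comp hN.measurable

lemma measurable_lintegral (hN : IsPoissonRandomMeasure P Λ N) {f : E → ℝ≥0∞}
    (hf : Measurable f) : Measurable fun ω => ∫⁻ x, f x ∂N ω :=
  (Measure.measurable_lintegral hf).comp hN.measurable

lemma map (hN : IsPoissonRandomMeasure P Λ N) {g : E → F} (hg : Measurable g) :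
    IsPoissonRandomMeasure P (Λ.map g) fun ω => (N ω).map g where
  measurable := (Measure.measurable_map g hg).comp hN.measurable
  lintegral_expNeg_lintegral f hf := by
    simp_rw [lintegral_map hf hg]
    rw [lintegral_map (by fun_prop) hg]
    exact hN.lintegral_expNeg_lintegral _ (hf.comp hg)

lemma lintegral_expNeg_setLIntegral (hN : IsPoissonRandomMeasure P Λ N) {B : Set E}
    (hB : MeasurableSet B) {f : E → ℝ≥0∞} (hf : Measurable f) :
    ∫⁻ ω, expNeg (∫⁻ x in B, f x ∂N ω) ∂P = expNeg (∫⁻ x in B, 1 - expNeg (f x) ∂Λ) := by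
  have hindicator (x : E) :
      1 - expNeg (B.indicator f x) = B.indicator (fun x => 1 - expNeg (f x)) x := by
    by_cases hx : x ∈ B <;> simp [hx]
  simp_rw [← lintegral_indicator hB, hN.lintegral_expNeg_lintegral _ (hf.indicator hB), hindicator]

lemma restrict (hN : IsPoissonRandomMeasure P Λ N) {B : Set E} (hB : MeasurableSet B) :
    IsPoissonRandomMeasure P (Λ.restrict B) fun ω => (N ω).restrict B where
  measurable := Measure.measurable_of_measurable_coe _ fun A hA => by
    simpa only [Measure.restrict_apply hA] using hN.measurable_apply (hA.inter hB)
  lintegral_expNeg_lintegral _ hf := hN.lintegral_expNeg_setLIntegral hB hf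

lemma indepFun_lintegral [IsProbabilityMeasure P] (hN : IsPoissonRandomMeasure P Λ N)
    {f g : E → ℝ≥0∞} (hf : Measurable f) (hg : Measurable g) (hfg : ∀ x, f x = 0 ∨ g x = 0) :
    IndepFun (fun ω => ∫⁻ x, f x ∂N ω) (fun ω => ∫⁻ x, g x ∂N ω) P := by
  refine indepFun_of_lintegral_expNeg_mul (hN.measurable_lintegral hf)
    (hN.measurable_lintegral hg) fun k l => ?_
  have hsplit (x : E) : 1 - expNeg (k * f x + l * g x) =
      (1 - expNeg (k * f x)) + (1 - expNeg (l * g x)) := by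
    rcases hfg x with h | h <;> simp [h]
  simp_rw [← expNeg_add, ← lintegral_const_mul _ hf, ← lintegral_const_mul _ hg]
  simp_rw [← lintegral_add_left (hf.const_mul (k : ℝ≥0∞))]
  rw [hN.lintegral_expNeg_lintegral _ (by fun_prop), hN.lintegral_expNeg_lintegral _ (by fun_prop),
    hN.lintegral_expNeg_lintegral _ (by fun_prop), ← expNeg_add, ← lintegral_add_left (by fun_prop)]
  simp_rw [hsplit]

lemma map_apply_eq_map_poissonMeasure [IsProbabilityMeasure P] (hN : IsPoissonRandomMeasure P Λ N)
    {B : Set E} (hB : MeasurableSet B) (hΛ : Λ B ≠ ∞) :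
    P.map (fun ω => N ω B) = (poissonMeasure (Λ B).toNNReal).map (fun k : ℕ => (k : ℝ≥0∞)) := by
  have : IsProbabilityMeasure (P.map fun ω => N ω B) :=
    Measure.isProbabilityMeasure_map (hN.measurable_apply hB).aemeasurable
  refine ext_of_lintegral_expNeg_nat_mul fun l => ?_
  have key := hN.lintegral_expNeg_setLIntegral hB (measurable_const (a := (l : ℝ≥0∞)))
  simp only [setLIntegral_const] at key
  rw [lintegral_map (by fun_prop) (hN.measurable_apply hB), key,
    lintegral_map (by fun_prop) .of_discrete]
  simp_rw [mul_comm (l : ℝ≥0∞)]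
  rw [lintegral_expNeg_mul_poissonMeasure, ENNReal.coe_toNNReal hΛ]

lemma measure_one_lt_apply_le [IsProbabilityMeasure P] (hN : IsPoissonRandomMeasure P Λ N)
    {B : Set E} (hB : MeasurableSet B) : P {ω | 1 < N ω B} ≤ Λ B ^ 2 := by
  rcases eq_or_ne (Λ B) ∞ with hΛ | hΛ
  · simp [hΛ]
  have key := congrArg (· (Ioi 1)) (hN.map_apply_eq_map_poissonMeasure hB hΛ)
  simp only [Measure.map_apply (hN.measurable_apply hB) measurableSet_Ioi,
    Measure.map_apply .of_discrete measurableSet_Ioi] at key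
  calc P {ω | 1 < N ω B} = poissonMeasure (Λ B).toNNReal (Ioi 1) := by
        simpa [preimage, Ioi] using key
    _ ≤ Λ B ^ 2 := by
        simpa only [ENNReal.coe_toNNReal hΛ] using poissonMeasure_Ioi_one_le (Λ B).toNNReal

lemma measure_apply_eq_zero (hN : IsPoissonRandomMeasure P Λ N) {B : Set E}
    (hB : MeasurableSet B) : P {ω | N ω B = 0} = expNeg (Λ B) := by
  have hmeas : MeasurableSet {ω | N ω B = 0} :=
    hN.measurable_apply hB (measurableSet_singleton 0)
  have key := hN.lintegral_expNeg_setLIntegral hB (measurable_const (a := ∞))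
  have hindicator (ω : Ω) : expNeg (∞ * N ω B) = {ω | N ω B = 0}.indicator 1 ω := by
    by_cases h : N ω B = 0 <;> simp [h, ENNReal.top_mul]
  simpa [hindicator, lintegral_indicator_one hmeas] using key

lemma ae_apply_eq_zero [IsProbabilityMeasure P] (hN : IsPoissonRandomMeasure P Λ N) {B : Set E}
    (hB : MeasurableSet B) (hΛ : Λ B = 0) : ∀ᵐ ω ∂P, N ω B = 0 := by
  refine (mem_ae_iff_prob_eq_one (hN.measurable_apply hB (measurableSet_singleton 0))).2 ?_
  exact (hN.measure_apply_eq_zero hB).trans (by simp [hΛ])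

lemma ae_apply_eq_top (hN : IsPoissonRandomMeasure P Λ N) {B : Set E} (hB : MeasurableSet B)
    (hΛ : Λ B = ∞) : ∀ᵐ ω ∂P, N ω B = ∞ := by
  have key := hN.lintegral_expNeg_setLIntegral hB (measurable_const (a := 1))
  have hpos : 1 - expNeg 1 ≠ 0 :=
    (tsub_pos_of_lt (by simpa using strictAnti_expNeg one_pos)).ne'
  simp only [setLIntegral_const, one_mul, hΛ, ENNReal.mul_top hpos, expNeg_top] at key
  filter_upwards [(lintegral_eq_zero_iff
    (measurable_expNeg.comp (hN.measurable_apply hB))).1 key] with ω hω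
  exact strictAnti_expNeg.injective (by simpa using hω)

lemma ae_lintegral_lt_top [IsProbabilityMeasure P] (hN : IsPoissonRandomMeasure P Λ N)
    {f : E → ℝ≥0∞} (hf : Measurable f) (hftop : ∀ x, f x ≠ ∞)
    (hΛ : ∫⁻ x, 1 - expNeg (f x) ∂Λ ≠ ∞) : ∀ᵐ ω ∂P, ∫⁻ x, f x ∂N ω < ∞ := by
  let I : Ω → ℝ≥0∞ := fun ω => ∫⁻ x, f x ∂N ω
  let ε : ℕ → ℝ≥0∞ := fun k => ((k + 1 : ℕ) : ℝ≥0∞)⁻¹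
  have hI : Measurable I := hN.measurable_lintegral hf
  have hlaplace (k : ℕ) :
      ∫⁻ ω, expNeg (ε k * I ω) ∂P = expNeg (∫⁻ x, 1 - expNeg (ε k * f x) ∂Λ) := by
    rw [← hN.lintegral_expNeg_lintegral _ (by fun_prop)]
    simp_rw [I, lintegral_const_mul _ hf]
  have hleft : Tendsto (fun k => ∫⁻ ω, expNeg (ε k * I ω) ∂P) atTop (𝓝 (P (I ⁻¹' Iio ∞))) := by
    rw [← lintegral_indicator_one (hI measurableSet_Iio)]
    refine tendsto_lintegral_of_dominated_convergence 1 (fun k => by fun_prop)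
      (fun k => ae_of_all _ fun ω => expNeg_le_one _) (by simp) (ae_of_all _ fun ω => ?_)
    by_cases hω : I ω = ∞
    · simp [hω, ε, ENNReal.mul_top, -Nat.cast_add]
    · simpa [ε, lt_top_iff_ne_top, hω] using tendsto_expNeg_inv_mul hω
  have hright : Tendsto (fun k => ∫⁻ x, 1 - expNeg (ε k * f x) ∂Λ) atTop (𝓝 0) := by
    rw [← lintegral_zero (μ := Λ)]
    refine tendsto_lintegral_of_dominated_convergence (fun x => 1 - expNeg (f x))
      (fun k => by fun_prop) (fun k => ae_of_all _ fun x => ?_) hΛ (ae_of_all _ fun x => ?_)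
    · refine tsub_le_tsub_left (strictAnti_expNeg.antitone (mul_le_of_le_one_left' ?_)) _
      exact ENNReal.inv_le_one.2 (by exact_mod_cast Nat.succ_pos k)
    · simpa [ε] using ENNReal.Tendsto.sub (tendsto_const_nhds (x := 1))
        (tendsto_expNeg_inv_mul (hftop x)) (Or.inl ENNReal.one_ne_top)
  refine (mem_ae_iff_prob_eq_one (hI measurableSet_Iio)).2 ?_
  refine tendsto_nhds_unique hleft ?_
  simpa [hlaplace, Function.comp_def] using (continuous_expNeg.tendsto 0).comp hright

end IsPoissonRandomMeasure

section CoarseDiagonal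

open MeasurableSpace

variable [CountablyGenerated E]

variable (E) in
/-- The pairs of points of `E` lying in the same cell of the `m`-th countable partition; as `m`
grows, these sets decrease to the diagonal. -/
def coarseDiagonal (m : ℕ) : Set (E × E) :=
  ⋃ s ∈ countablePartition E m, s ×ˢ s

lemma measurableSet_coarseDiagonal (m : ℕ) : MeasurableSet (coarseDiagonal E m) :=
  (finite_countablePartition E m).measurableSet_biUnion fun _ hs =>
    (measurableSet_countablePartition m hs).prod (measurableSet_countablePartition m hs)

lemma mem_coarseDiagonal_iff {m : ℕ} {p : E × E} : p ∈ coarseDiagonal E m ↔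
    ∀ s ∈ countablePartition E m, p.1 ∈ s ↔ p.2 ∈ s := by
  simp only [coarseDiagonal, mem_iUnion, mem_prod, exists_prop]
  refine ⟨fun ⟨t, ht, h1, h2⟩ s hs => ?_, fun h => ?_⟩
  · rw [← countablePartitionSet_eq_iff _ hs, ← countablePartitionSet_eq_iff _ hs,
      countablePartitionSet_of_mem ht h1, countablePartitionSet_of_mem ht h2]
  · exact ⟨_, countablePartitionSet_mem m p.1, mem_countablePartitionSet m p.1,
      (h _ (countablePartitionSet_mem m p.1)).1 (mem_countablePartitionSet m p.1)⟩

lemma antitone_coarseDiagonal : Antitone (coarseDiagonal E) := by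
  refine antitone_nat_of_succ_le fun m p hp => mem_coarseDiagonal_iff.2 fun s hs => ?_
  obtain ⟨S, hS, rfl⟩ := (measurableSet_generateFrom_countablePartition_iff (m + 1) s).1
    (measurableSet_succ_countablePartition m hs)
  exact exists_congr fun t => and_congr_right fun ht => mem_coarseDiagonal_iff.1 hp t (hS ht)

lemma iInter_coarseDiagonal [SeparatesPoints E] : ⋂ m, coarseDiagonal E m = diagonal E := by
  ext p
  simp only [mem_iInter, mem_coarseDiagonal_iff, mem_diagonal_iff]
  refine ⟨fun hp => ?_, fun hp m s _ => hp ▸ Iff.rfl⟩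
  have : @SeparatesPoints E (generateFrom (⋃ m, countablePartition E m)) := by
    rwa [generateFrom_iUnion_countablePartition]
  refine separating_of_generateFrom (⋃ m, countablePartition E m) _ _ fun s hs => ?_
  obtain ⟨m, hm⟩ := mem_iUnion.1 hs
  exact hp m s hm

lemma prod_self_coarseDiagonal (μ : Measure E) [SFinite μ] (m : ℕ) :
    μ.prod μ (coarseDiagonal E m) =
      ∑ s ∈ (finite_countablePartition E m).toFinset, μ s ^ 2 := by
  have hunion : coarseDiagonal E m =
      ⋃ s ∈ (finite_countablePartition E m).toFinset, s ×ˢ s := by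
    simp [coarseDiagonal]
  have hmeas : ∀ s ∈ (finite_countablePartition E m).toFinset, MeasurableSet (s ×ˢ s) :=
    fun s hs => by
      have := measurableSet_countablePartition m ((finite_countablePartition E m).mem_toFinset.1 hs)
      exact this.prod this
  rw [hunion, measure_biUnion_finset (fun s hs t ht hst => ?_) hmeas]
  · simp only [Measure.prod_prod, sq]
  · exact disjoint_prod.2 (Or.inl (disjoint_countablePartition
      ((finite_countablePartition E m).mem_toFinset.1 hs)
      ((finite_countablePartition E m).mem_toFinset.1 ht) hst))

lemma tendsto_prod_self_coarseDiagonal [SeparatesPoints E] (μ : Measure E) [IsFiniteMeasure μ]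
    [NullSingletonClass μ] : Tendsto (fun m => μ.prod μ (coarseDiagonal E m)) atTop (𝓝 0) := by
  have hnull : μ.prod μ (diagonal E) = 0 := by
    rw [← iInter_coarseDiagonal, Measure.measure_prod_null
      (.iInter measurableSet_coarseDiagonal), iInter_coarseDiagonal]
    refine ae_of_all _ fun x => ?_
    simp [diagonal, preimage]
  rw [← hnull, ← iInter_coarseDiagonal]
  exact tendsto_measure_iInter_atTop
    (fun m => (measurableSet_coarseDiagonal m).nullMeasurableSet) antitone_coarseDiagonal
    ⟨0, measure_ne_top _ _⟩

end CoarseDiagonal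

namespace IsPoissonRandomMeasure

variable {P : Measure Ω} {Λ : Measure E} {N : Ω → Measure E}

open MeasurableSpace in
/-- Two points can only coincide if, for every `m`, some cell of the `m`-th partition holds at
least two of them, which has probability at most `∑ (Λ cell) ^ 2`. -/
lemma ae_forall_singleton_le_one_of_isFiniteMeasure [IsProbabilityMeasure P]
    [CountablyGenerated E] [SeparatesPoints E] [IsFiniteMeasure Λ] [NullSingletonClass Λ]
    (hN : IsPoissonRandomMeasure P Λ N) : ∀ᵐ ω ∂P, ∀ x, N ω {x} ≤ 1 := by
  have hbound (m : ℕ) : P {ω | ¬∀ x, N ω {x} ≤ 1} ≤ Λ.prod Λ (coarseDiagonal E m) := by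
    rw [prod_self_coarseDiagonal]
    calc P {ω | ¬∀ x, N ω {x} ≤ 1}
        ≤ P (⋃ s ∈ (finite_countablePartition E m).toFinset, {ω | 1 < N ω s}) := by
          refine measure_mono fun ω hω => ?_
          obtain ⟨x, hx⟩ := not_forall.1 hω
          refine mem_biUnion (x := countablePartitionSet m x)
            ((finite_countablePartition E m).mem_toFinset.2 (countablePartitionSet_mem m x)) ?_
          exact (not_le.1 hx).trans_le
            (measure_mono (singleton_subset_iff.2 (mem_countablePartitionSet m x)))
      _ ≤ ∑ s ∈ (finite_countablePartition E m).toFinset, P {ω | 1 < N ω s} :=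
          measure_biUnion_finset_le _ _
      _ ≤ ∑ s ∈ (finite_countablePartition E m).toFinset, Λ s ^ 2 :=
          Finset.sum_le_sum fun s hs => hN.measure_one_lt_apply_le
            (measurableSet_countablePartition m ((finite_countablePartition E m).mem_toFinset.1 hs))
  exact nonpos_iff_eq_zero.1 (ge_of_tendsto' (tendsto_prod_self_coarseDiagonal Λ) hbound)

open MeasurableSpace in
lemma ae_forall_singleton_le_one [IsProbabilityMeasure P] [CountablyGenerated E]
    [SeparatesPoints E] [SigmaFinite Λ] [NullSingletonClass Λ]
    (hN : IsPoissonRandomMeasure P Λ N) : ∀ᵐ ω ∂P, ∀ x, N ω {x} ≤ 1 := by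
  have hlocal (m : ℕ) : ∀ᵐ ω ∂P, ∀ x, (N ω).restrict (spanningSets Λ m) {x} ≤ 1 := by
    have : IsFiniteMeasure (Λ.restrict (spanningSets Λ m)) :=
      isFiniteMeasure_restrict.2 (measure_spanningSets_lt_top Λ m).ne
    exact (hN.restrict
      (measurableSet_spanningSets Λ m)).ae_forall_singleton_le_one_of_isFiniteMeasure
  filter_upwards [ae_all_iff.2 hlocal] with ω hω x
  have hx : {x} ⊆ spanningSets Λ (spanningSetsIndex Λ x) :=
    singleton_subset_iff.2 (mem_spanningSetsIndex Λ x)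
  simpa only [Measure.restrict_eq_self _ hx] using hω (spanningSetsIndex Λ x) x

end IsPoissonRandomMeasure

section PointMeasure

/-- The counting measure of the points `Y i`, `i ∈ S`, with multiplicity. -/
def pointMeasure (S : Set ℕ) (Y : ℕ → E) : Measure E :=
  (Measure.count.restrict S).map Y

lemma pointMeasure_apply (S : Set ℕ) (Y : ℕ → E) {A : Set E} (hA : MeasurableSet A) :
    pointMeasure S Y A = {i ∈ S | Y i ∈ A}.encard := by
  rw [pointMeasure, Measure.map_apply .of_discrete hA, Measure.restrict_apply .of_discrete,
    Measure.count_apply .of_discrete, inter_comm]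
  rfl

lemma lintegral_pointMeasure_univ (Y : ℕ → E) {f : E → ℝ≥0∞} (hf : Measurable f) :
    ∫⁻ x, f x ∂pointMeasure univ Y = ∑' i, f (Y i) := by
  rw [pointMeasure, lintegral_map hf .of_discrete, Measure.restrict_univ, lintegral_count]

lemma measurable_pointMeasure_univ {X : ℕ → Ω → E} (hX : ∀ i, Measurable (X i)) :
    Measurable fun ω => pointMeasure univ fun i => X i ω :=
  Measure.measurable_of_measurable_coe _ fun A hA => by
    have hsum (ω : Ω) : pointMeasure univ (fun i => X i ω) A = ∑' i, A.indicator 1 (X i ω) := by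
      rw [← lintegral_pointMeasure_univ _ (measurable_one.indicator hA), lintegral_indicator_one hA]
    simp_rw [hsum]
    exact .tsum fun i => (measurable_one.indicator hA).comp (hX i)

lemma map_restrict_pointMeasure (S : Set ℕ) (Y : ℕ → E) {A : Set E} (hA : MeasurableSet A)
    {g : E → F} (hg : Measurable g) :
    ((pointMeasure S Y).restrict A).map g = pointMeasure {i ∈ S | Y i ∈ A} (g ∘ Y) := by
  rw [pointMeasure, Measure.restrict_map .of_discrete hA, Measure.restrict_restrict .of_discrete,
    Measure.map_map hg .of_discrete, inter_comm, pointMeasure]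
  rfl

end PointMeasure

lemma lintegral_expNeg_of_tendsto_monotone {P : Measure Ω} [IsFiniteMeasure P] {Λ : Measure E}
    {N : Ω → Measure E} (hN : Measurable N) {F : ℕ → E → ℝ≥0∞} {f : E → ℝ≥0∞}
    (hF : ∀ m, Measurable (F m)) (hmono : ∀ x, Monotone fun m => F m x)
    (hlim : ∀ x, Tendsto (fun m => F m x) atTop (𝓝 (f x)))
    (h : ∀ m, ∫⁻ ω, expNeg (∫⁻ x, F m x ∂N ω) ∂P = expNeg (∫⁻ x, 1 - expNeg (F m x) ∂Λ)) :
    ∫⁻ ω, expNeg (∫⁻ x, f x ∂N ω) ∂P = expNeg (∫⁻ x, 1 - expNeg (f x) ∂Λ) := by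
  have hleft : Tendsto (fun m => ∫⁻ ω, expNeg (∫⁻ x, F m x ∂N ω) ∂P) atTop
      (𝓝 (∫⁻ ω, expNeg (∫⁻ x, f x ∂N ω) ∂P)) := by
    refine tendsto_lintegral_of_dominated_convergence 1 (fun m => measurable_expNeg.comp
      ((Measure.measurable_lintegral (hF m)).comp hN)) (fun m => ae_of_all _ fun ω =>
      expNeg_le_one _) (by simp) (ae_of_all _ fun ω => (continuous_expNeg.tendsto _).comp ?_)
    exact lintegral_tendsto_of_tendsto_of_monotone (fun m => (hF m).aemeasurable)
      (ae_of_all _ hmono) (ae_of_all _ hlim)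
  have hright : Tendsto (fun m => ∫⁻ x, 1 - expNeg (F m x) ∂Λ) atTop
      (𝓝 (∫⁻ x, 1 - expNeg (f x) ∂Λ)) := by
    refine lintegral_tendsto_of_tendsto_of_monotone (fun m => by fun_prop)
      (ae_of_all _ fun x m k hmk => tsub_le_tsub_left (strictAnti_expNeg.antitone
        (hmono x hmk)) _) (ae_of_all _ fun x => ?_)
    exact ENNReal.Tendsto.sub tendsto_const_nhds ((continuous_expNeg.tendsto _).comp (hlim x))
      (Or.inl ENNReal.one_ne_top)
  simp_rw [h] at hleft
  exact tendsto_nhds_unique hleft ((continuous_expNeg.tendsto _).comp hright)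

namespace IsPoissonPointProcess

variable {P : Measure Ω} {Λ : Measure E} {X : ℕ → Ω → E}

lemma measurable_count (hX : IsPoissonPointProcess P Λ X) {A : Set E} (hA : MeasurableSet A) :
    Measurable fun ω => {i : ℕ | X i ω ∈ A}.encard := by
  have hreal : Measurable fun ω => (({i : ℕ | X i ω ∈ A}.encard : ℕ∞) : ℝ≥0∞) := by
    simpa [Function.comp_def, pointMeasure_apply _ _ hA] using
      (Measure.measurable_coe hA).comp (measurable_pointMeasure_univ hX.measurable)
  refine measurable_to_countable' fun n => ?_
  convert hreal (measurableSet_singleton (n : ℝ≥0∞)) using 1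
  ext ω
  simp

lemma lintegral_expNeg_mul_count [IsProbabilityMeasure P] (hX : IsPoissonPointProcess P Λ X)
    {A : Set E} (hA : MeasurableSet A) {c : ℝ≥0∞} (hΛ : c ≠ 0 → Λ A ≠ ∞) :
    ∫⁻ ω, expNeg (c * {i : ℕ | X i ω ∈ A}.encard) ∂P = expNeg ((1 - expNeg c) * Λ A) := by
  rcases eq_or_ne c 0 with rfl | hc
  · simp
  have key := congrArg (fun μ => ∫⁻ k, expNeg (c * (k : ℕ∞)) ∂μ) (hX.poisson_count A hA (hΛ hc))
  rw [lintegral_map .of_discrete (hX.measurable_count hA),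
    lintegral_map .of_discrete .of_discrete] at key
  simpa [mul_comm c, lintegral_expNeg_mul_poissonMeasure, ENNReal.coe_toNNReal (hΛ hc)] using key

lemma iIndepFun_count_fiber (hX : IsPoissonPointProcess P Λ X) (f : SimpleFunc E ℝ≥0∞) :
    iIndepFun (fun (c : f.range) ω => {i : ℕ | X i ω ∈ f ⁻¹' {(c : ℝ≥0∞)}}.encard) P := by
  let e := f.range.equivFin
  have hdisjoint : Pairwise fun j k => Disjoint (f ⁻¹' {(e.symm j : ℝ≥0∞)})
      (f ⁻¹' {(e.symm k : ℝ≥0∞)}) := fun j k hjk =>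
    Disjoint.preimage _ (disjoint_singleton.2 fun h => hjk (e.symm.injective (Subtype.ext h)))
  simpa only [e.symm_apply_apply] using (hX.indep_count f.range.card _
    (fun j => f.measurableSet_fiber (e.symm j)) hdisjoint).precomp e.injective

lemma lintegral_expNeg_simpleFunc [IsProbabilityMeasure P] (hX : IsPoissonPointProcess P Λ X)
    (f : SimpleFunc E ℝ≥0∞) (hΛ : ∀ c ≠ 0, Λ (f ⁻¹' {c}) ≠ ∞) :
    ∫⁻ ω, expNeg (∫⁻ x, f x ∂pointMeasure univ fun i => X i ω) ∂P =
      expNeg (∫⁻ x, 1 - expNeg (f x) ∂Λ) := by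
  have hfiber (c : ℝ≥0∞) : MeasurableSet (f ⁻¹' {c}) := f.measurableSet_fiber c
  have hright : ∫⁻ x, 1 - expNeg (f x) ∂Λ =
      ∑ c ∈ f.range, (1 - expNeg c) * Λ (f ⁻¹' {c}) := by
    rw [← SimpleFunc.map_lintegral (fun c => 1 - expNeg c) f, ← SimpleFunc.lintegral_eq_lintegral]
    rfl
  have hleft (ω : Ω) : expNeg (∫⁻ x, f x ∂pointMeasure univ fun i => X i ω) =
      ∏ c : f.range, expNeg (c * {i : ℕ | X i ω ∈ f ⁻¹' {(c : ℝ≥0∞)}}.encard) := by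
    rw [SimpleFunc.lintegral_eq_lintegral, SimpleFunc.lintegral, expNeg_sum,
      ← Finset.prod_coe_sort f.range]
    simp [pointMeasure_apply _ _ (hfiber _)]
  have hindep := (hX.iIndepFun_count_fiber f).comp (fun c k => expNeg (c * (k : ℕ∞)))
    fun c => .of_discrete
  simp_rw [hleft, hright, expNeg_sum]
  rw [← Finset.prod_coe_sort f.range]
  refine (lintegral_prod_eq_prod_lintegral_of_indepFun Finset.univ _ hindep fun c =>
    Measurable.comp .of_discrete (hX.measurable_count (hfiber _))).trans ?_
  exact Finset.prod_congr rfl fun c _ => hX.lintegral_expNeg_mul_count (hfiber _) (hΛ c)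

/-- Approximate `f` from below by simple functions supported on sets of finite intensity. -/
theorem isPoissonRandomMeasure [IsProbabilityMeasure P] [SigmaFinite Λ]
    (hX : IsPoissonPointProcess P Λ X) :
    IsPoissonRandomMeasure P Λ fun ω => pointMeasure univ fun i => X i ω where
  measurable := measurable_pointMeasure_univ hX.measurable
  lintegral_expNeg_lintegral f hf := by
    let S := spanningSets Λ
    have hS (m : ℕ) : MeasurableSet (S m) := measurableSet_spanningSets Λ m
    let F : ℕ → SimpleFunc E ℝ≥0∞ := fun m => (SimpleFunc.eapprox f m).restrict (S m)
    have hF (m : ℕ) (x : E) : F m x = (S m).indicator (SimpleFunc.eapprox f m) x :=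
      SimpleFunc.restrict_apply _ (hS m) x
    have hmono (x : E) : Monotone fun m => F m x := fun m k hmk => by
      simp only [hF]
      exact (indicator_le_indicator_of_subset (monotone_spanningSets Λ hmk)
        (fun _ => zero_le) x).trans (indicator_le_indicator (SimpleFunc.monotone_eapprox _ hmk x))
    have hlim (x : E) : Tendsto (fun m => F m x) atTop (𝓝 (f x)) := by
      refine (SimpleFunc.tendsto_eapprox hf x).congr' ?_
      filter_upwards [eventually_ge_atTop (spanningSetsIndex Λ x)] with m hm
      rw [hF, indicator_of_mem (mem_spanningSets_of_index_le Λ x hm)]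
    have hfin (m : ℕ) (c : ℝ≥0∞) (hc : c ≠ 0) : Λ (F m ⁻¹' {c}) ≠ ∞ := by
      rw [SimpleFunc.restrict_preimage_singleton _ (hS m) hc]
      exact ((measure_mono inter_subset_left).trans_lt (measure_spanningSets_lt_top Λ m)).ne
    exact lintegral_expNeg_of_tendsto_monotone (measurable_pointMeasure_univ hX.measurable)
      (fun m => (F m).measurable) hmono hlim fun m => hX.lintegral_expNeg_simpleFunc _ (hfin m)

end IsPoissonPointProcess

section Marking

variable {P : Measure Ω} {ν : Measure F} {X : ℕ → Ω → E} {h : ℕ → Ω → F}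

lemma lintegral_prod_range_marks [IsProbabilityMeasure P] (hX : ∀ i, Measurable (X i))
    (h_meas : ∀ i, Measurable (h i)) (h_law : ∀ i, P.map (h i) = ν) (h_indep : iIndepFun h P)
    (hX_indep : IndepFun (fun ω i => X i ω) (fun ω i => h i ω) P) {G : E × F → ℝ≥0∞}
    (hG : Measurable G) (k : ℕ) :
    ∫⁻ ω, ∏ i ∈ Finset.range k, G (X i ω, h i ω) ∂P =
      ∫⁻ ω, ∏ i ∈ Finset.range k, ∫⁻ η, G (X i ω, η) ∂ν ∂P := by
  have hXs : Measurable fun ω i => X i ω := measurable_pi_lambda _ hX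
  have hhs : Measurable fun ω i => h i ω := measurable_pi_lambda _ h_meas
  have := Measure.isProbabilityMeasure_map (μ := P) hhs.aemeasurable
  have hprod : Measurable fun p : (ℕ → E) × (ℕ → F) =>
      ∏ i ∈ Finset.range k, G (p.1 i, p.2 i) := by fun_prop
  have average (y : ℕ → E) :
      ∫⁻ ω, ∏ i ∈ Finset.range k, G (y i, h i ω) ∂P =
        ∏ i ∈ Finset.range k, ∫⁻ η, G (y i, η) ∂ν := by
    refine (lintegral_prod_eq_prod_lintegral_of_indepFun (Finset.range k) _
      (h_indep.comp (fun i η => G (y i, η)) fun i => by fun_prop) fun i => by fun_prop).trans ?_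
    refine Finset.prod_congr rfl fun i _ => ?_
    rw [← h_law i, lintegral_map (by fun_prop) (h_meas i)]
    rfl
  calc ∫⁻ ω, ∏ i ∈ Finset.range k, G (X i ω, h i ω) ∂P
      = ∫⁻ p, ∏ i ∈ Finset.range k, G (p.1 i, p.2 i)
          ∂(P.map fun ω i => X i ω).prod (P.map fun ω i => h i ω) := by
        rw [← (indepFun_iff_map_prod_eq_prod_map_map hXs.aemeasurable hhs.aemeasurable).1 hX_indep,
          lintegral_map hprod (hXs.prodMk hhs)]
    _ = ∫⁻ ω, ∫⁻ ω', ∏ i ∈ Finset.range k, G (X i ω, h i ω') ∂P ∂P := by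
        rw [lintegral_prod _ hprod.aemeasurable, lintegral_map hprod.lintegral_prod_right' hXs]
        refine lintegral_congr fun ω => ?_
        rw [lintegral_map (by fun_prop) hhs]
    _ = ∫⁻ ω, ∏ i ∈ Finset.range k, ∫⁻ η, G (X i ω, η) ∂ν ∂P := by simp_rw [average]

lemma tendsto_lintegral_prod_range_expNeg [IsFiniteMeasure P] {a : ℕ → Ω → ℝ≥0∞}
    (ha : ∀ i, Measurable (a i)) :
    Tendsto (fun k => ∫⁻ ω, ∏ i ∈ Finset.range k, expNeg (a i ω) ∂P) atTop
      (𝓝 (∫⁻ ω, expNeg (∑' i, a i ω) ∂P)) := by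
  simp_rw [← expNeg_sum]
  exact tendsto_lintegral_of_dominated_convergence 1 (fun k => by fun_prop)
    (fun k => ae_of_all _ fun ω => expNeg_le_one _) (by simp) (ae_of_all _ fun ω =>
      (continuous_expNeg.tendsto _).comp (ENNReal.tendsto_nat_tsum _))

/-- Averaging over the marks turns `e^(-f(x, η))` into another function of `x` with values in
`[0, 1]`, whose `negLog` serves as test function for the unmarked process. -/
theorem IsPoissonPointProcess.isPoissonRandomMeasure_marked [IsProbabilityMeasure P]
    {Λ : Measure E} [SigmaFinite Λ] (hX : IsPoissonPointProcess P Λ X)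
    (h_meas : ∀ i, Measurable (h i)) (h_law : ∀ i, P.map (h i) = ν) (h_indep : iIndepFun h P)
    (hX_indep : IndepFun (fun ω i => X i ω) (fun ω i => h i ω) P) :
    IsPoissonRandomMeasure P (Λ.prod ν) fun ω => pointMeasure univ fun i => (X i ω, h i ω) where
  measurable := measurable_pointMeasure_univ fun i => (hX.measurable i).prodMk (h_meas i)
  lintegral_expNeg_lintegral f hf := by
    have hXm := hX.measurable
    have : IsProbabilityMeasure ν :=
      h_law 0 ▸ Measure.isProbabilityMeasure_map (h_meas 0).aemeasurable
    let g : E → ℝ≥0∞ := fun x => ∫⁻ η, expNeg (f (x, η)) ∂ν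
    have hg : Measurable g := (measurable_expNeg.comp hf).lintegral_prod_right'
    have hg1 (x : E) : g x ≤ 1 := by
      simpa using lintegral_mono (μ := ν) fun η => expNeg_le_one (f (x, η))
    have hmarks : ∫⁻ ω, expNeg (∑' i, f (X i ω, h i ω)) ∂P =
        ∫⁻ ω, expNeg (∑' i, negLog (g (X i ω))) ∂P := by
      refine tendsto_nhds_unique (tendsto_lintegral_prod_range_expNeg fun i => by fun_prop) ?_
      have haverage (k : ℕ) := lintegral_prod_range_marks hXm h_meas h_law h_indep hX_indep
        (G := fun p => expNeg (f p)) (by fun_prop) k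
      simp_rw [haverage]
      simpa only [expNeg_negLog (hg1 _)] using tendsto_lintegral_prod_range_expNeg (P := P)
        (a := fun i ω => negLog (g (X i ω))) fun i => by fun_prop
    have hintensity : ∫⁻ p, 1 - expNeg (f p) ∂Λ.prod ν = ∫⁻ x, 1 - g x ∂Λ := by
      rw [lintegral_prod _ (by fun_prop)]
      refine lintegral_congr fun x => ?_
      rw [lintegral_sub (by fun_prop) (ne_top_of_le_ne_top ENNReal.one_ne_top (hg1 x))
        (ae_of_all _ fun η => expNeg_le_one _)]
      simp [g]
    have hneg : Measurable fun x => negLog (g x) := by fun_prop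
    have key := hX.isPoissonRandomMeasure.lintegral_expNeg_lintegral _ hneg
    simp_rw [lintegral_pointMeasure_univ _ hneg, expNeg_negLog (hg1 _)] at key
    simp_rw [lintegral_pointMeasure_univ _ hf, hmarks, hintensity, key]

end Marking

section RightDiscretization

/-- The least point of the grid `ℤ / (m + 1)` that is greater than `y`; as `m` grows it
discretizes `y` from the right. -/
def gridSucc (m : ℕ) (y : ℝ) : ℝ := (⌊y * (m + 1)⌋ + 1) / (m + 1)

lemma lt_gridSucc (m : ℕ) (y : ℝ) : y < gridSucc m y := by
  rw [gridSucc, lt_div_iff₀ (by positivity)]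
  exact Int.lt_floor_add_one _

lemma gridSucc_le (m : ℕ) (y : ℝ) : gridSucc m y ≤ y + 1 / (m + 1) := by
  rw [gridSucc, div_le_iff₀ (by positivity), add_mul, one_div_mul_cancel (by positivity)]
  gcongr
  exact Int.floor_le _

lemma tendsto_gridSucc (y : ℝ) : Tendsto (fun m => gridSucc m y) atTop (𝓝[>] y) := by
  refine tendsto_nhdsWithin_iff.2 ⟨?_, Eventually.of_forall fun m => lt_gridSucc m y⟩
  refine tendsto_of_tendsto_of_tendsto_of_le_of_le tendsto_const_nhds ?_
    (fun m => (lt_gridSucc m y).le) (fun m => gridSucc_le m y)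
  simpa using (tendsto_const_nhds (x := y)).add (tendsto_one_div_add_atTop_nhds_zero_nat (𝕜 := ℝ))

lemma measurable_floor_mul (m : ℕ) : Measurable fun y : ℝ => ⌊y * (m + 1)⌋ :=
  Int.measurable_floor.comp (measurable_id.mul_const _)

variable {P : Measure Ω} {T : Ω → ℝ} {G H : ℝ → Ω → ℝ≥0∞}

lemma measurable_apply_gridSucc (hT : Measurable T) (hG : ∀ b, Measurable (G b)) (m : ℕ) :
    Measurable fun ω => G (gridSucc m (T ω)) ω :=
  (measurable_from_prod_countable_left (f := fun p : Ω × ℤ => G ((p.2 + 1) / (m + 1)) p.1)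
    fun j => hG ((j + 1) / (m + 1))).comp (measurable_id.prodMk ((measurable_floor_mul m).comp hT))

lemma setLIntegral_gridSucc_congr (hT : Measurable T)
    (h : ∀ b, ∀ B ⊆ Iio b, MeasurableSet B →
      ∫⁻ ω in T ⁻¹' B, G b ω ∂P = ∫⁻ ω in T ⁻¹' B, H b ω ∂P)
    {B : Set ℝ} (hB : MeasurableSet B) (m : ℕ) :
    ∫⁻ ω in T ⁻¹' B, G (gridSucc m (T ω)) ω ∂P =
      ∫⁻ ω in T ⁻¹' B, H (gridSucc m (T ω)) ω ∂P := by
  let cell (j : ℤ) : Set ℝ := B ∩ (fun y : ℝ => ⌊y * (m + 1)⌋) ⁻¹' {j}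
  have hcell (j : ℤ) : MeasurableSet (cell j) :=
    hB.inter (measurable_floor_mul m (measurableSet_singleton j))
  have hgrid (j : ℤ) (y : ℝ) (hy : y ∈ cell j) : gridSucc m y = (j + 1) / (m + 1) := by
    rw [gridSucc, show ⌊y * ((m : ℝ) + 1)⌋ = j from hy.2]
  have hunion : T ⁻¹' B = ⋃ j, T ⁻¹' cell j := by
    ext ω
    simp [cell]
  have hdisjoint : Pairwise (Function.onFun Disjoint fun j => T ⁻¹' cell j) := fun j k hjk =>
    Disjoint.preimage _ (disjoint_left.2 fun y hj hk => hjk (hj.2.symm.trans hk.2))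
  have hconst (K : ℝ → Ω → ℝ≥0∞) (j : ℤ) :
      ∫⁻ ω in T ⁻¹' cell j, K (gridSucc m (T ω)) ω ∂P =
        ∫⁻ ω in T ⁻¹' cell j, K ((j + 1) / (m + 1)) ω ∂P :=
    setLIntegral_congr_fun (hT (hcell j)) fun ω hω => by rw [hgrid j _ hω]
  simp_rw [hunion, lintegral_iUnion (fun j => hT (hcell j)) hdisjoint, hconst]
  refine tsum_congr fun j => h _ _ (fun y hy => ?_) (hcell j)
  rw [mem_Iio, ← hgrid j y hy]
  exact lt_gridSucc m y

lemma tendsto_setLIntegral_gridSucc [IsFiniteMeasure P] (hT : Measurable T)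
    (hG : ∀ b, Measurable (G b)) (hG_le : ∀ b ω, G b ω ≤ 1)
    (hG_lim : ∀ a ω, Tendsto (fun b => G b ω) (𝓝[>] a) (𝓝 (G a ω))) (B : Set ℝ) :
    Tendsto (fun m => ∫⁻ ω in T ⁻¹' B, G (gridSucc m (T ω)) ω ∂P) atTop
      (𝓝 (∫⁻ ω in T ⁻¹' B, G (T ω) ω ∂P)) :=
  tendsto_lintegral_of_dominated_convergence 1 (fun m => measurable_apply_gridSucc hT hG m)
    (fun m => ae_of_all _ fun ω => hG_le _ ω) (by simp)
    (ae_of_all _ fun ω => (hG_lim _ ω).comp (tendsto_gridSucc (T ω)))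

theorem setLIntegral_apply_self_congr [IsFiniteMeasure P] (hT : Measurable T)
    (hG : ∀ b, Measurable (G b)) (hG_le : ∀ b ω, G b ω ≤ 1)
    (hG_lim : ∀ a ω, Tendsto (fun b => G b ω) (𝓝[>] a) (𝓝 (G a ω)))
    (hH : ∀ b, Measurable (H b)) (hH_le : ∀ b ω, H b ω ≤ 1)
    (hH_lim : ∀ a ω, Tendsto (fun b => H b ω) (𝓝[>] a) (𝓝 (H a ω)))
    (h : ∀ b, ∀ B ⊆ Iio b, MeasurableSet B →
      ∫⁻ ω in T ⁻¹' B, G b ω ∂P = ∫⁻ ω in T ⁻¹' B, H b ω ∂P)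
    {B : Set ℝ} (hB : MeasurableSet B) :
    ∫⁻ ω in T ⁻¹' B, G (T ω) ω ∂P = ∫⁻ ω in T ⁻¹' B, H (T ω) ω ∂P := by
  have hG_tendsto := tendsto_setLIntegral_gridSucc (P := P) hT hG hG_le hG_lim B
  simp_rw [setLIntegral_gridSucc_congr hT h hB] at hG_tendsto
  exact tendsto_nhds_unique hG_tendsto (tendsto_setLIntegral_gridSucc hT hH hH_le hH_lim B)

end RightDiscretization

section StrongMarkov

lemma tendsto_setLIntegral_Ioi (μ : Measure ℝ) (f : ℝ → ℝ≥0∞) (a : ℝ) :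
    Tendsto (fun b => ∫⁻ x in Ioi b, f x ∂μ) (𝓝[>] a) (𝓝 (∫⁻ x in Ioi a, f x ∂μ)) := by
  obtain ⟨u, hu, hua, hulim⟩ := exists_seq_strictAnti_tendsto a
  have hunion : Ioi a = ⋃ n, Ioi (u n) := by
    ext x
    simp only [mem_Ioi, mem_iUnion]
    exact ⟨fun hx => (hulim.eventually_lt_const hx).exists, fun ⟨n, hn⟩ => (hua n).trans hn⟩
  have hmono : Monotone fun n => Ioi (u n) := fun m n hmn => Ioi_subset_Ioi (hu.antitone hmn)
  refine tendsto_order.2 ⟨fun c hc => ?_, fun c hc => ?_⟩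
  · rw [hunion, setLIntegral_iUnion_of_directed _ hmono.directed_le, lt_iSup_iff] at hc
    obtain ⟨n, hn⟩ := hc
    filter_upwards [Ioo_mem_nhdsGT (hua n)] with b hb
    exact hn.trans_le (lintegral_mono_set (Ioi_subset_Ioi hb.2.le))
  · filter_upwards [self_mem_nhdsWithin] with b hb
    exact (lintegral_mono_set (Ioi_subset_Ioi (le_of_lt hb))).trans_lt hc

lemma indepFun_of_measure_Iic_inter_preimage {P : Measure Ω} [IsProbabilityMeasure P] {T : Ω → ℝ}
    {U : Ω → E} (hT : Measurable T) (hU : Measurable U)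
    (h : ∀ a, ∀ B, MeasurableSet B →
      P (T ⁻¹' Iic a ∩ U ⁻¹' B) = P (T ⁻¹' Iic a) * P (U ⁻¹' B)) :
    IndepFun T U P := by
  have hgenerate : MeasurableSpace.comap T inferInstance =
      MeasurableSpace.generateFrom (preimage T '' range Iic) := by
    rw [BorelSpace.measurable_eq (α := ℝ), borel_eq_generateFrom_Iic,
      MeasurableSpace.comap_generateFrom]
  refine IndepSets.indep hT.comap_le hU.comap_le (isPiSystem_Iic.comap T)
    (@MeasurableSpace.isPiSystem_measurableSet Ω (.comap U inferInstance)) hgenerate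
    (@MeasurableSpace.generateFrom_measurableSet Ω (.comap U inferInstance)).symm
    ((IndepSets_iff _ _ _).2 ?_)
  rintro _ _ ⟨_, ⟨a, rfl⟩, rfl⟩ ⟨B, hB, rfl⟩
  exact h a B hB

namespace IsPoissonRandomMeasure

variable {P : Measure Ω} [IsProbabilityMeasure P] {Λ : Measure ℝ} {N : Ω → Measure ℝ} {T : Ω → ℝ}
  {c : ℝ≥0∞} {f : ℝ → ℝ≥0∞}

lemma indepFun_min_setLIntegral_Ioi (hN : IsPoissonRandomMeasure P Λ N) (hT : Measurable T)
    (hT_le : ∀ a, T ⁻¹' Iic a =ᵐ[P] {ω | c ≤ N ω (Iic a)}) (hf : Measurable f) (b : ℝ) :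
    IndepFun (fun ω => min (T ω) b) (fun ω => ∫⁻ x in Ioi b, f x ∂N ω) P := by
  refine indepFun_of_measure_Iic_inter_preimage (hT.min measurable_const)
    ((hN.restrict measurableSet_Ioi).measurable_lintegral hf) fun a B hB => ?_
  rcases le_or_gt b a with hba | hab
  · have huniv : (fun ω => min (T ω) b) ⁻¹' Iic a = univ := by
      ext ω
      simp [hba]
    simp [huniv]
  have hevent : (fun ω => min (T ω) b) ⁻¹' Iic a =ᵐ[P] (fun ω => N ω (Iic a)) ⁻¹' Ici c := by
    have hset : (fun ω => min (T ω) b) ⁻¹' Iic a = T ⁻¹' Iic a := by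
      ext ω
      simp [hab.not_ge]
    exact hset ▸ hT_le a
  have hindep := hN.indepFun_lintegral (measurable_one.indicator measurableSet_Iic)
    (hf.indicator measurableSet_Ioi) (f := (Iic a).indicator 1) (g := (Ioi b).indicator f)
    fun x => by
      by_cases hx : x ≤ a
      · exact .inr (indicator_of_notMem (hx.trans hab.le).not_gt f)
      · exact .inl (indicator_of_notMem hx 1)
  simp_rw [lintegral_indicator_one measurableSet_Iic, lintegral_indicator measurableSet_Ioi]
    at hindep
  rw [measure_congr (hevent.inter (ae_eq_refl ((fun ω => ∫⁻ x in Ioi b, f x ∂N ω) ⁻¹' B))),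
    measure_congr hevent]
  exact hindep.measure_inter_preimage_eq_mul _ _ measurableSet_Ici hB

lemma setLIntegral_expNeg_setLIntegral_Ioi_of_subset_Iio (hN : IsPoissonRandomMeasure P Λ N)
    (hT : Measurable T) (hT_le : ∀ a, T ⁻¹' Iic a =ᵐ[P] {ω | c ≤ N ω (Iic a)})
    (hf : Measurable f) {b : ℝ} {B : Set ℝ} (hBb : B ⊆ Iio b) (hB : MeasurableSet B) :
    ∫⁻ ω in T ⁻¹' B, expNeg (∫⁻ x in Ioi b, f x ∂N ω) ∂P =
      ∫⁻ _ in T ⁻¹' B, expNeg (∫⁻ x in Ioi b, 1 - expNeg (f x) ∂Λ) ∂P := by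
  have hmin : T ⁻¹' B = (fun ω => min (T ω) b) ⁻¹' B := by
    ext ω
    rcases le_or_gt b (T ω) with hb | hb
    · simp [hb, notMem_subset hBb (lt_irrefl b), notMem_subset hBb (not_lt.2 hb)]
    · simp [hb.le]
  have hint := (hN.restrict (measurableSet_Ioi (a := b))).measurable_lintegral hf
  have hprod (ω : Ω) : ((fun ω => min (T ω) b) ⁻¹' B).indicator
      (fun ω => expNeg (∫⁻ x in Ioi b, f x ∂N ω)) ω =
        B.indicator 1 (min (T ω) b) * expNeg (∫⁻ x in Ioi b, f x ∂N ω) := by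
    by_cases h : min (T ω) b ∈ B <;> simp [h]
  rw [setLIntegral_const, hmin, ← lintegral_indicator ((hT.min measurable_const) hB)]
  simp_rw [hprod]
  have hindep := (hN.indepFun_min_setLIntegral_Ioi hT hT_le hf b).comp
    (measurable_one.indicator hB : Measurable (B.indicator (1 : ℝ → ℝ≥0∞))) measurable_expNeg
  refine (lintegral_mul_eq_lintegral_mul_lintegral_of_indepFun''
    ((measurable_one.indicator hB).comp (hT.min measurable_const)).aemeasurable
    (measurable_expNeg.comp hint).aemeasurable hindep).trans ?_
  rw [← lintegral_indicator_one ((hT.min measurable_const) hB), mul_comm]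
  congr 1
  exact hN.lintegral_expNeg_setLIntegral measurableSet_Ioi hf

/-- The strong Markov property at the first level `T` below which the mass is at least `c`. -/
theorem setLIntegral_expNeg_setLIntegral_Ioi (hN : IsPoissonRandomMeasure P Λ N)
    (hT : Measurable T) (hT_le : ∀ a, T ⁻¹' Iic a =ᵐ[P] {ω | c ≤ N ω (Iic a)})
    (hf : Measurable f) {B : Set ℝ} (hB : MeasurableSet B) :
    ∫⁻ ω in T ⁻¹' B, expNeg (∫⁻ x in Ioi (T ω), f x ∂N ω) ∂P =
      ∫⁻ ω in T ⁻¹' B, expNeg (∫⁻ x in Ioi (T ω), 1 - expNeg (f x) ∂Λ) ∂P :=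
  setLIntegral_apply_self_congr hT
    (G := fun b ω => expNeg (∫⁻ x in Ioi b, f x ∂N ω))
    (H := fun b _ => expNeg (∫⁻ x in Ioi b, 1 - expNeg (f x) ∂Λ))
    (fun _ => measurable_expNeg.comp
      ((hN.restrict measurableSet_Ioi).measurable_lintegral hf))
    (fun _ _ => expNeg_le_one _)
    (fun a ω => (continuous_expNeg.tendsto _).comp (tendsto_setLIntegral_Ioi (N ω) f a))
    (fun _ => measurable_const) (fun _ _ => expNeg_le_one _)
    (fun a _ => (continuous_expNeg.tendsto _).comp (tendsto_setLIntegral_Ioi Λ _ a))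
    (fun _ _ hBb hB => hN.setLIntegral_expNeg_setLIntegral_Ioi_of_subset_Iio hT hT_le hf hBb hB) hB

end IsPoissonRandomMeasure
end StrongMarkov

section OrderStatistics

lemma exists_strictMono_range_eq {A : Set ℝ} (hA : A.Infinite)
    (hfin : ∀ t, (A ∩ Iic t).Finite) : ∃ y : ℕ → ℝ, StrictMono y ∧ range y = A := by
  have hIcc (a b : A) : (Icc a b).Finite :=
    ((hfin b).subset (image_subset_iff.2 fun x hx => ⟨x.2, hx.2⟩)).of_finite_image
      Subtype.val_injective.injOn
  obtain ⟨a, ha⟩ := hA.nonempty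
  obtain ⟨m, hm, hmin⟩ := exists_min_image (A ∩ Iic a) id (hfin a) ⟨a, ha, self_mem_Iic⟩
  let := LocallyFiniteOrder.ofFiniteIcc hIcc
  let : OrderBot A :=
    { bot := ⟨m, hm.1⟩
      bot_le := fun x => by
        rcases le_total (x : ℝ) a with hx | hx
        · exact hmin x ⟨x.2, hx⟩
        · exact show m ≤ (x : ℝ) from (mem_Iic.1 hm.2).trans hx }
  have : NoMaxOrder A := ⟨fun b => by
    obtain ⟨x, hxA, hx⟩ := (hA.sdiff (hfin b)).nonempty
    exact ⟨⟨x, hxA⟩, not_le.1 fun h => hx ⟨hxA, h⟩⟩⟩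
  let := LinearLocallyFiniteOrder.succOrder A
  let := LinearLocallyFiniteOrder.predOrder A
  let e : A ≃o ℕ := orderIsoNatOfLinearSuccPredArch
  exact ⟨fun k => e.symm k, fun k l hkl => e.symm.strictMono hkl,
    (e.symm.surjective.range_comp _).trans Subtype.range_coe⟩

lemma succ_le_encard_setOf_le_iff {y : ℕ → ℝ} (hy : StrictMono y) (n : ℕ) (t : ℝ) :
    ((n + 1 : ℕ) : ℕ∞) ≤ {k | y k ≤ t}.encard ↔ y n ≤ t := by
  refine ⟨fun h => ?_, fun h => ?_⟩
  · by_contra! ht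
    have hsub : {k | y k ≤ t} ⊆ Iio n := fun k hk => hy.lt_iff_lt.1 (hk.trans_lt ht)
    have hcard := h.trans (encard_le_encard hsub)
    rw [← Finset.coe_Iio, encard_coe_eq_coe_finsetCard, Nat.card_Iio, Nat.cast_le] at hcard
    lia
  · have hsub : Iic n ⊆ {k | y k ≤ t} := fun k hk => (hy.monotone hk).trans h
    simpa only [← Finset.coe_Iic, encard_coe_eq_coe_finsetCard, Nat.card_Iic] using
      encard_le_encard hsub

/-- The `n`-th smallest of the values `Y i`, `i ∈ S`, for `n = 1, 2, …`. -/
def orderStat (S : Set ℕ) (Y : ℕ → ℝ) (n : ℕ) : ℝ :=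
  sInf {t : ℝ | (n : ℕ∞) ≤ {i ∈ S | Y i ≤ t}.encard}

/-- The values `Y i`, `i ∈ S`, are infinitely many, pairwise distinct, and finitely many of them
lie below any given level, so that they can be arranged in increasing order. -/
structure IsOrderable (S : Set ℕ) (Y : ℕ → ℝ) : Prop where
  infinite : S.Infinite
  injOn : InjOn Y S
  finite_le : ∀ t, {i ∈ S | Y i ≤ t}.Finite

namespace IsOrderable

variable {S : Set ℕ} {Y y : ℕ → ℝ}

lemma of_pointMeasure (huniv : pointMeasure S Y univ = ∞)
    (hatom : ∀ x, pointMeasure S Y {x} ≤ 1) (hIic : ∀ t, pointMeasure S Y (Iic t) < ∞) :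
    IsOrderable S Y where
  infinite := by simpa [pointMeasure_apply _ _ .univ, encard_eq_top_iff] using huniv
  injOn i hi j hj hij := by
    have hcard := hatom (Y j)
    rw [pointMeasure_apply _ _ (measurableSet_singleton _)] at hcard
    have hle : {k ∈ S | Y k ∈ ({Y j} : Set ℝ)}.encard ≤ 1 := by exact_mod_cast hcard
    exact encard_le_one_iff.1 hle i j ⟨hi, hij⟩ ⟨hj, rfl⟩
  finite_le t := by
    have hcard := hIic t
    rw [pointMeasure_apply _ _ measurableSet_Iic] at hcard
    exact encard_lt_top_iff.1 (by simpa using hcard)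

lemma encard_setOf_mem_eq (hY : InjOn Y S) (hy : y.Injective) (hrange : range y = Y '' S)
    (A : Set ℝ) : {i ∈ S | Y i ∈ A}.encard = {k | y k ∈ A}.encard := by
  have himage : Y '' {i ∈ S | Y i ∈ A} = y '' {k | y k ∈ A} := by
    rw [show {i ∈ S | Y i ∈ A} = S ∩ Y ⁻¹' A from rfl, show {k | y k ∈ A} = y ⁻¹' A from rfl,
      image_inter_preimage, image_preimage_eq_range_inter, hrange]
  rw [← (hY.mono (sep_subset S _)).encard_image, himage, hy.encard_image]

lemma orderStat_succ (hY : InjOn Y S) (hy : StrictMono y) (hrange : range y = Y '' S) (k : ℕ) :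
    orderStat S Y (k + 1) = y k := by
  have hlevel : {t : ℝ | ((k + 1 : ℕ) : ℕ∞) ≤ {i ∈ S | Y i ≤ t}.encard} = Ici (y k) := by
    ext t
    exact (congrArg _ (encard_setOf_mem_eq hY hy.injective hrange (Iic t))).to_iff.trans
      (succ_le_encard_setOf_le_iff hy k t)
  rw [orderStat, hlevel, csInf_Ici]

theorem strictMono_orderStat_and_range_eq (H : IsOrderable S Y) :
    StrictMono (fun k => orderStat S Y (k + 1)) ∧
      range (fun k => orderStat S Y (k + 1)) = Y '' S := by
  have hfin (t : ℝ) : (Y '' S ∩ Iic t).Finite := by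
    rw [← image_inter_preimage]
    exact (H.finite_le t).image Y
  obtain ⟨y, hy, hrange⟩ := exists_strictMono_range_eq (H.infinite.image H.injOn) hfin
  simp_rw [orderStat_succ H.injOn hy hrange]
  exact ⟨hy, hrange⟩

lemma orderStat_le_iff (H : IsOrderable S Y) {n : ℕ} (hn : 1 ≤ n) (t : ℝ) :
    orderStat S Y n ≤ t ↔ (n : ℝ≥0∞) ≤ pointMeasure S Y (Iic t) := by
  obtain ⟨k, rfl⟩ := Nat.exists_eq_add_of_le' hn
  obtain ⟨hy, hrange⟩ := H.strictMono_orderStat_and_range_eq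
  rw [pointMeasure_apply _ _ measurableSet_Iic,
    encard_setOf_mem_eq H.injOn hy.injective hrange (Iic t)]
  exact (succ_le_encard_setOf_le_iff hy k t).symm.trans (by norm_cast)

lemma pointMeasure_eq (H : IsOrderable S Y) :
    pointMeasure S Y = pointMeasure univ fun k => orderStat S Y (k + 1) := by
  obtain ⟨hy, hrange⟩ := H.strictMono_orderStat_and_range_eq
  ext A hA
  rw [pointMeasure_apply _ _ hA, pointMeasure_apply _ _ hA,
    encard_setOf_mem_eq H.injOn hy.injective hrange A]
  simp

lemma setLIntegral_Ioi_orderStat (H : IsOrderable S Y) {n : ℕ} (hn : 1 ≤ n) {f : ℝ → ℝ≥0∞}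
    (hf : Measurable f) :
    ∫⁻ x in Ioi (orderStat S Y n), f x ∂pointMeasure S Y =
      ∑' k, f (orderStat S Y (n + 1 + k)) := by
  obtain ⟨m, rfl⟩ := Nat.exists_eq_add_of_le' hn
  have hy := H.strictMono_orderStat_and_range_eq.1
  have hindicator (k : ℕ) : (Ioi (orderStat S Y (m + 1))).indicator f (orderStat S Y (k + 1)) =
      if m < k then f (orderStat S Y (k + 1)) else 0 := by
    simp only [indicator_apply, mem_Ioi, hy.lt_iff_lt]
  rw [H.pointMeasure_eq, ← lintegral_indicator measurableSet_Ioi,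
    lintegral_pointMeasure_univ _ (hf.indicator measurableSet_Ioi)]
  simp_rw [hindicator]
  rw [← ENNReal.summable.sum_add_tsum_nat_add' (k := m + 1),
    Finset.sum_eq_zero fun k hk => if_neg (by simpa [Nat.lt_succ_iff] using hk), zero_add]
  refine tsum_congr fun k => ?_
  rw [if_pos (by lia), show k + (m + 1) + 1 = m + 1 + 1 + k by lia]

end IsOrderable
end OrderStatistics

section LowerGamma

lemma integrableOn_rpow_mul_exp_neg_Ioi (b : ℝ) {y : ℝ} (hy : 0 < y) :
    IntegrableOn (fun t : ℝ => t ^ b * Real.exp (-t)) (Ioi y) := by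
  refine integrable_of_isBigO_exp_neg (b := 1 / 2) (by norm_num) ?_ ?_
  · refine ContinuousOn.mul (fun t ht => ?_) (by fun_prop)
    exact (Real.continuousAt_rpow_const _ _ (.inl (hy.trans_le ht).ne')).continuousWithinAt
  · exact (Real.Gamma_integrand_isLittleO b).isBigO.congr_left fun t => mul_comm _ _

lemma hasDerivAt_lowerGamma (a : ℝ) {y : ℝ} (hy : 0 < y) :
    HasDerivAt (lowerGamma a) (y ^ (a - 1) * Real.exp (-y)) y := by
  have hcont (t : ℝ) (ht : t ∈ Ioi 0) :
      ContinuousAt (fun t : ℝ => t ^ (a - 1) * Real.exp (-t)) t :=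
    (Real.continuousAt_rpow_const _ _ (.inl ht.ne')).mul (by fun_prop)
  have hy2 : 0 < y / 2 := half_pos hy
  have hint : IntervalIntegrable (fun t : ℝ => t ^ (a - 1) * Real.exp (-t)) volume (y / 2) y :=
    (intervalIntegrable_iff_integrableOn_Ioc_of_le (half_le_self hy.le)).2
      ((integrableOn_rpow_mul_exp_neg_Ioi _ hy2).mono_set Ioc_subset_Ioi_self)
  have hderiv := intervalIntegral.integral_hasDerivAt_right hint
    (ContinuousAt.stronglyMeasurableAtFilter isOpen_Ioi hcont y hy) (hcont y hy)
  refine (hderiv.const_add (lowerGamma a (y / 2))).congr_of_eventuallyEq ?_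
  filter_upwards [lt_mem_nhds (half_lt_self hy)] with u hu
  rw [← intervalIntegral.integral_Ioi_sub_Ioi (integrableOn_rpow_mul_exp_neg_Ioi _ hy2) hu.le,
    lowerGamma, lowerGamma]
  ring

lemma lowerGamma_add_one {a : ℝ} (ha : a ≠ 0) {y : ℝ} (hy : 0 < y) :
    lowerGamma (a + 1) y = a * lowerGamma a y - y ^ a * Real.exp (-y) := by
  have hderiv (t : ℝ) (ht : t ∈ Ici y) : HasDerivAt (fun t : ℝ => t ^ a * Real.exp (-t))
      (a * (t ^ (a - 1) * Real.exp (-t)) - t ^ a * Real.exp (-t)) t := by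
    refine ((Real.hasDerivAt_rpow_const (.inl (hy.trans_le ht).ne')).mul
      (hasDerivAt_neg t).exp).congr_deriv ?_
    ring
  have hint := (integrableOn_rpow_mul_exp_neg_Ioi (a - 1) hy).const_mul a
  have hparts := integral_Ioi_of_hasDerivAt_of_tendsto' hderiv
    (hint.sub (integrableOn_rpow_mul_exp_neg_Ioi a hy))
    (by simpa using tendsto_rpow_mul_exp_neg_mul_atTop_nhds_zero a 1 one_pos)
  rw [integral_sub hint (integrableOn_rpow_mul_exp_neg_Ioi a hy), integral_const_mul] at hparts
  rw [lowerGamma, lowerGamma, Real.Gamma_add_one ha, add_sub_cancel_right]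
  linear_combination hparts

lemma intervalIntegrable_rpow_mul_exp_neg {b : ℝ} (hb : -1 < b) (x y : ℝ) :
    IntervalIntegrable (fun t : ℝ => t ^ b * Real.exp (-t)) volume x y :=
  (intervalIntegral.intervalIntegrable_rpow' hb).mul_continuousOn (by fun_prop)

lemma lowerGamma_eq_intervalIntegral {a : ℝ} (ha : 0 < a) {y : ℝ} (hy : 0 < y) :
    lowerGamma a y = ∫ t in (0)..y, t ^ (a - 1) * Real.exp (-t) := by
  have hint : IntegrableOn (fun t : ℝ => t ^ (a - 1) * Real.exp (-t)) (Ioi 0) := by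
    simpa only [mul_comm] using Real.GammaIntegral_convergent ha
  rw [← intervalIntegral.integral_Ioi_sub_Ioi hint hy.le, lowerGamma, Real.Gamma_eq_integral ha]
  simp only [mul_comm]

lemma tendsto_lowerGamma_zero {a : ℝ} (ha : 0 < a) :
    Tendsto (lowerGamma a) (𝓝[>] 0) (𝓝 0) := by
  have hprimitive := (intervalIntegral.continuous_primitive
    (intervalIntegrable_rpow_mul_exp_neg (b := a - 1) (by linarith)) 0).tendsto 0
  rw [intervalIntegral.integral_same] at hprimitive
  refine (hprimitive.mono_left nhdsWithin_le_nhds).congr' ?_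
  filter_upwards [self_mem_nhdsWithin] with y hy
  exact (lowerGamma_eq_intervalIntegral ha hy).symm

lemma tendsto_rpow_neg_mul_one_sub_exp_neg {a : ℝ} (ha : a < 1) :
    Tendsto (fun y : ℝ => y ^ (-a) * (1 - Real.exp (-y))) (𝓝[>] 0) (𝓝 0) := by
  have hpow : Tendsto (fun y : ℝ => y ^ (1 - a)) (𝓝[>] 0) (𝓝 0) := by
    have hcont := (Real.continuousAt_rpow_const 0 (1 - a) (.inr (by linarith))).tendsto
    rw [Real.zero_rpow (by linarith)] at hcont
    exact hcont.mono_left nhdsWithin_le_nhds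
  refine squeeze_zero' ?_ ?_ hpow
  · filter_upwards [self_mem_nhdsWithin] with y (hy : 0 < y)
    exact mul_nonneg (Real.rpow_nonneg hy.le _)
      (sub_nonneg.2 (Real.exp_le_one_iff.2 (neg_nonpos.2 hy.le)))
  · filter_upwards [self_mem_nhdsWithin] with y (hy : 0 < y)
    rw [sub_eq_neg_add 1 a, Real.rpow_add_one hy.ne']
    exact mul_le_mul_of_nonneg_left (by linarith [Real.add_one_le_exp (-y)])
      (Real.rpow_nonneg hy.le _)

lemma tendsto_lowerGamma_neg_add {a : ℝ} (ha0 : 0 < a) (ha1 : a < 1) :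
    Tendsto (fun y => lowerGamma (-a) y + 1 / a * y ^ (-a)) (𝓝[>] 0) (𝓝 0) := by
  have hlim := ((tendsto_rpow_neg_mul_one_sub_exp_neg ha1).sub
    (tendsto_lowerGamma_zero (sub_pos.2 ha1))).const_mul (1 / a)
  rw [sub_zero, mul_zero] at hlim
  refine hlim.congr' ?_
  filter_upwards [self_mem_nhdsWithin] with y hy
  rw [sub_eq_neg_add 1 a, lowerGamma_add_one (neg_ne_zero.2 ha0.ne') hy]
  field_simp
  ring

end LowerGamma

section LaplaceExponent

variable {α s t : ℝ}

lemma rpow_mul_div_rpow_neg (a : ℝ) (hs : 0 < s) (ht : 0 < t) :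
    s ^ a * (s / t) ^ (-a) = t ^ a := by
  rw [Real.rpow_neg (div_pos hs ht).le, Real.div_rpow hs.le ht.le, inv_div,
    mul_div_cancel₀ _ (Real.rpow_pos_of_pos hs a).ne']

lemma hasDerivAt_q (hα : α ≠ 0) (hs : 0 < s) (ht : 0 < t) :
    HasDerivAt (fun t => q α t s) ((1 - Real.exp (-(s / t))) * t ^ (2 / α - 1)) t := by
  have hdiv : HasDerivAt (fun t => s / t) (-(s / t ^ 2)) t := by
    simpa [div_eq_mul_inv, neg_mul] using (hasDerivAt_inv ht.ne').const_mul s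
  have hgamma := (((hasDerivAt_lowerGamma (-(2 / α)) (div_pos hs ht)).comp t hdiv).const_mul
    (s ^ (2 / α)))
  have hpow := (Real.hasDerivAt_rpow_const (p := 2 / α) (.inl ht.ne')).const_mul (α / 2)
  refine (hgamma.add hpow).congr_deriv ?_
  have hscale := rpow_mul_div_rpow_neg (2 / α) hs ht
  rw [Real.rpow_sub_one (div_pos hs ht).ne', Real.rpow_sub_one ht.ne']
  calc _ = -(s ^ (2 / α) * (s / t) ^ (-(2 / α))) / t * Real.exp (-(s / t)) +
        t ^ (2 / α) / t := by field_simp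
    _ = _ := by rw [hscale]; ring

lemma tendsto_q_atTop (hα : 2 < α) (hs : 0 < s) :
    Tendsto (fun t => q α t s) atTop (𝓝 0) := by
  have hdiv : Tendsto (fun t => s / t) atTop (𝓝[>] 0) := by
    refine tendsto_nhdsWithin_iff.2 ⟨tendsto_const_nhds.div_atTop tendsto_id, ?_⟩
    filter_upwards [eventually_gt_atTop 0] with t ht using div_pos hs ht
  have hlim := ((tendsto_lowerGamma_neg_add (a := 2 / α) (by positivity)
    ((div_lt_one (by linarith)).2 hα)).comp hdiv).const_mul (s ^ (2 / α))
  rw [mul_zero] at hlim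
  refine hlim.congr' ?_
  filter_upwards [eventually_gt_atTop 0] with t ht
  simp only [Function.comp_apply, q, one_div_div]
  linear_combination (α / 2) * rpow_mul_div_rpow_neg (2 / α) hs ht

lemma one_sub_exp_mul_rpow_nonneg (b : ℝ) (hs : 0 < s) (ht : 0 < t) :
    0 ≤ (1 - Real.exp (-(s / t))) * t ^ b :=
  mul_nonneg (sub_nonneg.2 (Real.exp_le_one_iff.2 (neg_nonpos.2 (div_pos hs ht).le)))
    (Real.rpow_nonneg ht.le _)

lemma q_nonpos (hα : 2 < α) (hs : 0 < s) (ht : 0 < t) : q α t s ≤ 0 := by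
  have hderiv (u : ℝ) (hu : u ∈ Ici t) := hasDerivAt_q (α := α) (by linarith) hs (ht.trans_le hu)
  have hmono : MonotoneOn (fun t => q α t s) (Ici t) :=
    monotoneOn_of_deriv_nonneg (convex_Ici t)
      (fun u hu => (hderiv u hu).continuousAt.continuousWithinAt)
      (fun u hu => (hderiv u (interior_subset hu)).differentiableAt.differentiableWithinAt)
      fun u hu => by
        rw [(hderiv u (interior_subset hu)).deriv]
        exact one_sub_exp_mul_rpow_nonneg _ hs (ht.trans_le (interior_subset hu))
  refine ge_of_tendsto (tendsto_q_atTop hα hs) ?_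
  filter_upwards [eventually_ge_atTop t] with u hu
  exact hmono self_mem_Ici hu hu

lemma lintegral_Ioi_one_sub_exp_mul_rpow (hα : 2 < α) (hs : 0 < s) (ht : 0 < t) :
    ∫⁻ y in Ioi t, ENNReal.ofReal ((1 - Real.exp (-(s / y))) * y ^ (2 / α - 1)) =
      ENNReal.ofReal (-q α t s) := by
  have hderiv (y : ℝ) (hy : y ∈ Ici t) := hasDerivAt_q (α := α) (by linarith) hs (ht.trans_le hy)
  have hnonneg (y : ℝ) (hy : y ∈ Ioi t) :=
    one_sub_exp_mul_rpow_nonneg (2 / α - 1) hs (ht.trans hy)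
  rw [← ofReal_integral_eq_lintegral_ofReal
    (integrableOn_Ioi_deriv_of_nonneg' hderiv hnonneg (tendsto_q_atTop hα hs))
    (ae_restrict_of_forall_mem measurableSet_Ioi hnonneg),
    integral_Ioi_of_hasDerivAt_of_nonneg' hderiv hnonneg (tendsto_q_atTop hα hs), zero_sub]

lemma continuousAt_q (hs : 0 < s) (ht : 0 < t) : ContinuousAt (fun s => q α t s) s := by
  have hgamma : ContinuousAt (fun s => lowerGamma (-(2 / α)) (s / t)) s :=
    ContinuousAt.comp (f := fun s => s / t)
      (hasDerivAt_lowerGamma _ (div_pos hs ht)).continuousAt (by fun_prop)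
  exact ((Real.continuousAt_rpow_const _ _ (.inl hs.ne')).mul hgamma).add continuousAt_const

end LaplaceExponent

section Sector

lemma measurable_toIcoMod {T : ℝ} (hT : 0 < T) (a : ℝ) : Measurable (toIcoMod hT a) := by
  have hfract : toIcoMod hT a = fun b => a + Int.fract ((b - a) / T) * T :=
    funext (toIcoMod_eq_add_fract_mul hT a)
  rw [hfract]
  fun_prop

lemma volume_toIcoMod_preimage_inter_Ioc {T : ℝ} (hT : 0 < T) (a b : ℝ) {s : Set ℝ}
    (hs : MeasurableSet s) :
    volume (toIcoMod hT a ⁻¹' s ∩ Ioc b (b + T)) = volume (s ∩ Ico a (a + T)) := by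
  have hperiod (g : AddSubgroup.zmultiples T) :
      (fun θ => g +ᵥ θ) ⁻¹' (toIcoMod hT a ⁻¹' s) = toIcoMod hT a ⁻¹' s := by
    obtain ⟨m, hm⟩ := AddSubgroup.mem_zmultiples_iff.1 g.2
    ext θ
    simp only [mem_preimage, AddSubgroup.vadd_def, ← hm, vadd_eq_add, toIcoMod_zsmul_add]
  calc volume (toIcoMod hT a ⁻¹' s ∩ Ioc b (b + T))
    _ = volume (toIcoMod hT a ⁻¹' s ∩ Ioc a (a + T)) :=
        (isAddFundamentalDomain_Ioc hT b).measure_set_eq (isAddFundamentalDomain_Ioc hT a)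
          (measurable_toIcoMod hT a hs) hperiod
    _ = volume (toIcoMod hT a ⁻¹' s ∩ Ico a (a + T)) :=
        measure_congr ((ae_eq_refl _).inter Ico_ae_eq_Ioc.symm)
    _ = volume (s ∩ Ico a (a + T)) := by
        congr 1
        ext θ
        simp only [mem_inter_iff, mem_preimage]
        exact and_congr_left fun hθ => by rw [(toIcoMod_eq_self hT).2 hθ]

lemma lintegral_Ioi_indicator_Iic_ofReal {r : ℝ} (hr : 0 ≤ r) :
    ∫⁻ y in Ioi 0, (Iic r).indicator ENNReal.ofReal y = ENNReal.ofReal (r ^ 2 / 2) := by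
  rw [setLIntegral_indicator measurableSet_Iic, inter_comm, Ioi_inter_Iic,
    ← ofReal_integral_eq_lintegral_ofReal (f := fun y : ℝ => y)
      ((intervalIntegrable_iff_integrableOn_Ioc_of_le hr).1 intervalIntegral.intervalIntegrable_id)
      (ae_restrict_of_forall_mem measurableSet_Ioc fun y hy => hy.1.le),
    ← intervalIntegral.integral_of_le hr, integral_id, zero_pow two_ne_zero, sub_zero]

lemma volume_setOf_arg_mem_norm_le {Θ : Set ℝ} (hΘ : MeasurableSet Θ) {r : ℝ} (hr : 0 ≤ r) :
    volume {w : ℂ | w.arg ∈ Θ ∧ ‖w‖ ≤ r} =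
      ENNReal.ofReal (r ^ 2 / 2) * volume (Θ ∩ Ioc (-Real.pi) Real.pi) := by
  have hS : MeasurableSet {w : ℂ | w.arg ∈ Θ ∧ ‖w‖ ≤ r} :=
    (Complex.measurable_arg hΘ).inter (measurableSet_le measurable_norm measurable_const)
  have hpolar (p : ℝ × ℝ) (hp : p ∈ polarCoord.target) :
      ENNReal.ofReal p.1 • {w : ℂ | w.arg ∈ Θ ∧ ‖w‖ ≤ r}.indicator 1 (Complex.polarCoord.symm p) =
        (Iic r).indicator ENNReal.ofReal p.1 * Θ.indicator 1 p.2 := by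
    obtain ⟨hp1, hp2⟩ : 0 < p.1 ∧ p.2 ∈ Ioo (-Real.pi) Real.pi := hp
    have harg : (Complex.polarCoord.symm p).arg = p.2 := by
      rw [Complex.polarCoord_symm_apply]
      exact_mod_cast Complex.arg_mul_cos_add_sin_mul_I hp1 ⟨hp2.1, hp2.2.le⟩
    have hmem : Complex.polarCoord.symm p ∈ {w : ℂ | w.arg ∈ Θ ∧ ‖w‖ ≤ r} ↔
        p.2 ∈ Θ ∧ p.1 ≤ r := by
      rw [mem_ofPred_eq, harg, Complex.norm_polarCoord_symm, abs_of_pos hp1]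
    classical
    simp only [indicator_apply, hmem, mem_Iic]
    by_cases hθ : p.2 ∈ Θ <;> by_cases hle : p.1 ≤ r <;> simp [hθ, hle]
  rw [← lintegral_indicator_one hS, ← Complex.lintegral_comp_polarCoord_symm,
    setLIntegral_congr_fun polarCoord.open_target.measurableSet hpolar, polarCoord_target,
    Measure.volume_eq_prod, ← Measure.prod_restrict, lintegral_prod_mul
      (ENNReal.measurable_ofReal.indicator measurableSet_Iic).aemeasurable
      (measurable_one.indicator hΘ).aemeasurable,
    lintegral_Ioi_indicator_Iic_ofReal hr, lintegral_indicator_one hΘ, Measure.restrict_apply hΘ,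
    measure_congr ((ae_eq_refl Θ).inter Ioo_ae_eq_Ioc)]

@[fun_prop]
lemma measurable_polarAngle : Measurable polarAngle :=
  (measurable_toIcoMod _ _).comp <| Complex.measurable_arg.comp <|
    Complex.measurableEquivRealProd.symm.measurable.comp
      (f := fun v : Plane => (v 0, v 1)) (by fun_prop)

lemma volume_sector (x : Plane) {φ : ℝ} (hφ1 : φ ≤ 2 * Real.pi) {r : ℝ}
    (hr : 0 ≤ r) :
    volume {p : Plane | polarAngle (p - x) ≤ φ ∧ ‖p - x‖ ≤ r} = ENNReal.ofReal (φ / 2 * r ^ 2) := by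
  let e := Complex.orthonormalBasisOneI.repr.symm
  let Θ := toIcoMod Real.two_pi_pos 0 ⁻¹' Iic φ
  have hΘ : MeasurableSet Θ := measurable_toIcoMod _ _ measurableSet_Iic
  have hvolume_Θ : volume (Θ ∩ Ioc (-Real.pi) Real.pi) = ENNReal.ofReal φ := by
    have hangle := volume_toIcoMod_preimage_inter_Ioc Real.two_pi_pos 0 (-Real.pi)
      (measurableSet_Iic (a := φ))
    rw [zero_add, show -Real.pi + 2 * Real.pi = Real.pi by ring,
      measure_congr ((ae_eq_refl (Iic φ)).inter Ico_ae_eq_Icc), ← Ici_inter_Iic,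
      inter_left_comm, Iic_inter_Iic, min_eq_left hφ1, Ici_inter_Iic, Real.volume_Icc,
      sub_zero] at hangle
    exact hangle
  have he (v : Plane) : e v = ⟨v 0, v 1⟩ := by
    apply Complex.ext <;> simp [e, Complex.orthonormalBasisOneI]
  have hpreimage : {p : Plane | polarAngle (p - x) ≤ φ ∧ ‖p - x‖ ≤ r} =
      (fun p => p - x) ⁻¹' (e ⁻¹' {w : ℂ | w.arg ∈ Θ ∧ ‖w‖ ≤ r}) := by
    ext p
    rw [mem_preimage, mem_preimage, mem_ofPred_eq, mem_ofPred_eq, e.norm_map, he]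
    rfl
  have hS : MeasurableSet {w : ℂ | w.arg ∈ Θ ∧ ‖w‖ ≤ r} :=
    (Complex.measurable_arg hΘ).inter (measurableSet_le measurable_norm measurable_const)
  rw [hpreimage, (measurePreserving_sub_right volume x).measure_preimage
      (e.measurePreserving.measurable hS).nullMeasurableSet,
    e.measurePreserving.measure_preimage hS.nullMeasurableSet,
    volume_setOf_arg_mem_norm_le hΘ hr, hvolume_Θ, ← ENNReal.ofReal_mul (by positivity)]
  congr 1
  ring

end Sector

section PowerIntensity

/-- The measure `κ y^(a-1) dy` on `(0, ∞)`: the intensity of the inverse powers of the interferers,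
for `a = 2/α` and a suitable `κ`. -/
def powerIntensity (a κ : ℝ) : Measure ℝ :=
  (volume.restrict (Ioi 0)).withDensity fun y => ENNReal.ofReal (κ * y ^ (a - 1))

variable {a κ : ℝ}

instance : SigmaFinite (powerIntensity a κ) :=
  inferInstanceAs (SigmaFinite (Measure.withDensity _ _))

instance : NullSingletonClass (powerIntensity a κ) :=
  inferInstanceAs (NullSingletonClass (Measure.withDensity _ _))

lemma lintegral_powerIntensity {f : ℝ → ℝ≥0∞} (hf : Measurable f) {s : Set ℝ}
    (hs : MeasurableSet s) :
    ∫⁻ y in s, f y ∂powerIntensity a κ =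
      ∫⁻ y in s ∩ Ioi 0, ENNReal.ofReal (κ * y ^ (a - 1)) * f y := by
  rw [powerIntensity, restrict_withDensity hs, Measure.restrict_restrict hs,
    lintegral_withDensity_eq_lintegral_mul _ (by fun_prop) hf]
  rfl

lemma powerIntensity_apply {s : Set ℝ} (hs : MeasurableSet s) :
    powerIntensity a κ s = ∫⁻ y in s ∩ Ioi 0, ENNReal.ofReal (κ * y ^ (a - 1)) := by
  simpa using lintegral_powerIntensity (a := a) (κ := κ) measurable_one hs

lemma powerIntensity_Iic_zero : powerIntensity a κ (Iic 0) = 0 := by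
  rw [powerIntensity_apply measurableSet_Iic, Iic_inter_Ioi, Ioc_self]
  simp

lemma powerIntensity_Iic (ha : 0 < a) (hκ : 0 ≤ κ) {t : ℝ} (ht : 0 ≤ t) :
    powerIntensity a κ (Iic t) = ENNReal.ofReal (κ / a * t ^ a) := by
  have hint : IntegrableOn (fun y : ℝ => κ * y ^ (a - 1)) (Ioc 0 t) :=
    ((intervalIntegrable_iff_integrableOn_Ioc_of_le ht).1
      (intervalIntegral.intervalIntegrable_rpow' (by linarith))).const_mul κ
  rw [powerIntensity_apply measurableSet_Iic, Iic_inter_Ioi,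
    ← ofReal_integral_eq_lintegral_ofReal hint (ae_restrict_of_forall_mem measurableSet_Ioc
      fun y hy => mul_nonneg hκ (Real.rpow_nonneg hy.1.le _)),
    ← intervalIntegral.integral_of_le ht, intervalIntegral.integral_const_mul,
    integral_rpow (.inl (by linarith)), sub_add_cancel, Real.zero_rpow ha.ne', sub_zero]
  congr 1
  ring

lemma powerIntensity_Iic_lt_top (ha : 0 < a) (hκ : 0 ≤ κ) (t : ℝ) :
    powerIntensity a κ (Iic t) < ∞ :=
  (measure_mono (Iic_subset_Iic.2 (le_max_left t 0))).trans_lt <| by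
    rw [powerIntensity_Iic ha hκ (le_max_right t 0)]
    exact ENNReal.ofReal_lt_top

lemma powerIntensity_univ (ha : 0 < a) (hκ : 0 < κ) : powerIntensity a κ univ = ∞ := by
  have hlim : Tendsto (fun t : ℝ => ENNReal.ofReal (κ / a * t ^ a)) atTop (𝓝 ∞) :=
    ENNReal.tendsto_ofReal_atTop.comp ((tendsto_rpow_atTop ha).const_mul_atTop (by positivity))
  refine top_unique (le_of_tendsto hlim ?_)
  filter_upwards [eventually_ge_atTop 0] with t ht
  rw [← powerIntensity_Iic ha hκ.le ht]
  exact measure_mono (subset_univ _)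

lemma measure_ext_of_Iic {μ μ' : Measure ℝ} (hμ : ∀ t, μ (Iic t) ≠ ∞)
    (h : ∀ t, μ (Iic t) = μ' (Iic t)) : μ = μ' := by
  refine Measure.ext_of_generateFrom_of_iUnion (range Iic) (fun n : ℕ => Iic (n : ℝ))
    (borel_eq_generateFrom_Iic ℝ ▸ BorelSpace.measurable_eq) isPiSystem_Iic
    (eq_univ_of_forall fun y => mem_iUnion.2 (exists_nat_ge y)) (fun n => mem_range_self _)
    (fun n => hμ n) ?_
  rintro _ ⟨t, rfl⟩
  exact h t

end PowerIntensity

section InversePowerIntensity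

variable {α φ lam : ℝ}

lemma volume_sector_norm_rpow_div_le (x : Plane) (hα : 0 < α) (hφ1 : φ ≤ 2 * Real.pi) {η t : ℝ}
    (hη : 0 < η) (ht : 0 ≤ t) :
    volume {p : Plane | polarAngle (p - x) ≤ φ ∧ ‖p - x‖ ^ α / η ≤ t} =
      ENNReal.ofReal (φ / 2 * t ^ (2 / α)) * ENNReal.ofReal (η ^ (2 / α)) := by
  have hradius (p : Plane) : ‖p - x‖ ^ α / η ≤ t ↔ ‖p - x‖ ≤ (t * η) ^ α⁻¹ := by
    rw [div_le_iff₀ hη, Real.le_rpow_inv_iff_of_pos (norm_nonneg _) (by positivity) hα]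
  simp_rw [hradius]
  rw [volume_sector x hφ1 (by positivity), ← ENNReal.ofReal_mul' (by positivity),
    ← Real.rpow_mul_natCast (by positivity), Real.mul_rpow ht hη.le]
  congr 1
  rw [Nat.cast_ofNat, inv_mul_eq_div]
  ring

lemma lintegral_volume_sector_norm_rpow_div_le (x : Plane) (hlam : 0 ≤ lam) (hα : 0 < α)
    (hφ0 : 0 ≤ φ) (hφ1 : φ ≤ 2 * Real.pi) {ν : Measure ℝ} (h_pos : ∀ᵐ t ∂ν, 0 < t)
    (h_mom : Integrable (fun t : ℝ => t ^ (2 / α)) ν) (t : ℝ) :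
    ∫⁻ η, ENNReal.ofReal lam *
        volume {p : Plane | polarAngle (p - x) ≤ φ ∧ ‖p - x‖ ^ α / η ≤ t} ∂ν =
      powerIntensity (2 / α) (φ * lam / α * ∫ t, t ^ (2 / α) ∂ν) (Iic t) := by
  have hpow_nonneg : ∀ᵐ t ∂ν, 0 ≤ t ^ (2 / α) :=
    h_pos.mono fun t ht => Real.rpow_nonneg ht.le _
  have hm : 0 ≤ ∫ t, t ^ (2 / α) ∂ν := integral_nonneg_of_ae hpow_nonneg
  rcases lt_or_ge t 0 with ht | ht
  · rw [measure_mono_null (Iic_subset_Iic.2 ht.le) powerIntensity_Iic_zero]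
    refine lintegral_eq_zero_of_ae_eq_zero ?_
    filter_upwards [h_pos] with η hη
    have hempty (p : Plane) : ¬(polarAngle (p - x) ≤ φ ∧ ‖p - x‖ ^ α / η ≤ t) := fun hp =>
      (hp.2.trans_lt ht).not_ge (by positivity)
    simp [hempty]
  · have hsector : ∀ᵐ η ∂ν, ENNReal.ofReal lam *
        volume {p : Plane | polarAngle (p - x) ≤ φ ∧ ‖p - x‖ ^ α / η ≤ t} =
        ENNReal.ofReal (lam * (φ / 2 * t ^ (2 / α))) * ENNReal.ofReal (η ^ (2 / α)) := by
      filter_upwards [h_pos] with η hη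
      rw [volume_sector_norm_rpow_div_le x hα hφ1 hη ht, ENNReal.ofReal_mul hlam, mul_assoc]
    rw [lintegral_congr_ae hsector, lintegral_const_mul' _ _ ENNReal.ofReal_ne_top,
      ← ofReal_integral_eq_lintegral_ofReal h_mom hpow_nonneg,
      ← ENNReal.ofReal_mul (by positivity),
      powerIntensity_Iic (by positivity) (by positivity) ht]
    congr 1
    field_simp

lemma map_inversePower (x : Plane) (hlam : 0 ≤ lam) (hα : 0 < α) (hφ0 : 0 ≤ φ)
    (hφ1 : φ ≤ 2 * Real.pi) (ν : Measure ℝ) [SFinite ν] (h_pos : ∀ᵐ t ∂ν, 0 < t)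
    (h_mom : Integrable (fun t : ℝ => t ^ (2 / α)) ν) :
    (((ENNReal.ofReal lam • volume : Measure Plane).prod ν).restrict
      {p | polarAngle (p.1 - x) ≤ φ}).map (fun p => ‖p.1 - x‖ ^ α / p.2) =
      powerIntensity (2 / α) (φ * lam / α * ∫ t, t ^ (2 / α) ∂ν) := by
  have hm : 0 ≤ ∫ t, t ^ (2 / α) ∂ν :=
    integral_nonneg_of_ae (h_pos.mono fun t ht => Real.rpow_nonneg ht.le _)
  have hpower : Measurable fun p : Plane × ℝ => ‖p.1 - x‖ ^ α / p.2 := by fun_prop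
  have hsector : MeasurableSet {p : Plane × ℝ | polarAngle (p.1 - x) ≤ φ} :=
    measurableSet_le (by fun_prop) measurable_const
  refine (measure_ext_of_Iic
    (fun t => (powerIntensity_Iic_lt_top (by positivity) (by positivity) t).ne) fun t => ?_).symm
  rw [← lintegral_volume_sector_norm_rpow_div_le x hlam hα hφ0 hφ1 h_pos h_mom,
    Measure.map_apply hpower measurableSet_Iic, Measure.restrict_apply (hpower measurableSet_Iic),
    inter_comm, Measure.prod_apply_symm (hsector.inter (hpower measurableSet_Iic))]
  rfl

end InversePowerIntensity

section CondDistrib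

variable {P : Measure Ω} [IsProbabilityMeasure P]

lemma ae_lintegral_condDistrib_eq [StandardBorelSpace F] [Nonempty F] {Z : Ω → E} {I : Ω → F}
    (hZ : AEMeasurable Z P) (hI : AEMeasurable I P) {ψ : F → ℝ≥0∞} (hψ : Measurable ψ)
    {g : E → ℝ≥0∞} (hg : Measurable g)
    (h : ∀ B, MeasurableSet B →
      ∫⁻ ω in Z ⁻¹' B, ψ (I ω) ∂P = ∫⁻ ω in Z ⁻¹' B, g (Z ω) ∂P) :
    ∀ᵐ ω ∂P, ∫⁻ u, ψ u ∂condDistrib I Z P (Z ω) = g (Z ω) := by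
  refine ae_of_ae_map hZ (ae_eq_of_forall_setLIntegral_eq_of_sigmaFinite
    (Measurable.lintegral_kernel_prod_right' (hψ.comp measurable_snd)) hg fun B hB _ => ?_)
  have hdisint := Measure.setLIntegral_compProd (μ := P.map Z) (κ := condDistrib I Z P)
    (hψ.comp measurable_snd) hB MeasurableSet.univ
  rw [compProd_map_condDistrib hI, Measure.restrict_map_of_aemeasurable (hZ.prodMk hI)
    (hB.prod .univ), lintegral_map' (hψ.comp measurable_snd).aemeasurable
    (hZ.prodMk hI).restrict, mk_preimage_prod, preimage_univ, inter_univ] at hdisint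
  simp only [Measure.restrict_univ, Function.comp_apply] at hdisint
  calc ∫⁻ t in B, ∫⁻ u, ψ u ∂condDistrib I Z P t ∂P.map Z
    _ = ∫⁻ ω in Z ⁻¹' B, ψ (I ω) ∂P := hdisint.symm
    _ = ∫⁻ ω in Z ⁻¹' B, g (Z ω) ∂P := h B hB
    _ = ∫⁻ t in B, g t ∂P.map Z := by
        rw [Measure.restrict_map_of_aemeasurable hZ hB, lintegral_map' hg.aemeasurable hZ.restrict]

lemma ae_ae_condDistrib [StandardBorelSpace F] [Nonempty F] {Z : Ω → E} {I : Ω → F}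
    (hZ : AEMeasurable Z P) (hI : AEMeasurable I P) {p : F → Prop} (hp : MeasurableSet {u | p u})
    (h : ∀ᵐ ω ∂P, p (I ω)) : ∀ᵐ ω ∂P, ∀ᵐ u ∂condDistrib I Z P (Z ω), p u := by
  refine ae_of_ae_map hZ (Measure.ae_ae_of_ae_compProd (p := fun q : E × F => p q.2) ?_)
  rw [compProd_map_condDistrib hI]
  exact (ae_map_iff (hZ.prodMk hI) (measurable_snd hp)).2 h

lemma continuousOn_integral_exp_neg_mul {μ : Measure ℝ} [IsFiniteMeasure μ]
    (h : ∀ᵐ u ∂μ, 0 ≤ u) : ContinuousOn (fun s => ∫ u, Real.exp (-s * u) ∂μ) (Ici 0) := by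
  refine continuousOn_of_dominated (bound := fun _ => 1) (fun s _ => by fun_prop) (fun s hs => ?_)
    (integrable_const 1) (ae_of_all _ fun u => by fun_prop)
  filter_upwards [h] with u hu
  rw [Real.norm_of_nonneg (Real.exp_pos _).le, Real.exp_le_one_iff, neg_mul]
  exact neg_nonpos.2 (mul_nonneg hs hu)

/-- By continuity in `s`, rational values of `s` suffice. -/
lemma ae_forall_integral_exp_condDistrib_eq {Z : Ω → E} {I : Ω → ℝ} (hZ : AEMeasurable Z P)
    (hI : AEMeasurable I P) (hI0 : ∀ᵐ ω ∂P, 0 ≤ I ω) {G : E → ℝ → ℝ}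
    (hG : ∀ᵐ ω ∂P, ContinuousOn (G (Z ω)) (Ioi 0))
    (h : ∀ s, 0 < s → ∀ᵐ ω ∂P, ∫ u, Real.exp (-s * u) ∂condDistrib I Z P (Z ω) = G (Z ω) s) :
    ∀ᵐ ω ∂P, ∀ s, 0 < s →
      ∫ u, Real.exp (-s * u) ∂condDistrib I Z P (Z ω) = G (Z ω) s := by
  have hrat : ∀ᵐ ω ∂P, ∀ r : ℚ, 0 < (r : ℝ) →
      ∫ u, Real.exp (-r * u) ∂condDistrib I Z P (Z ω) = G (Z ω) r := by
    simp_rw [ae_all_iff]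
    exact fun r hr => h r hr
  filter_upwards [hrat, hG, ae_ae_condDistrib hZ hI measurableSet_Ici hI0] with ω hω hGω hnonneg
  have heq : EqOn (fun s => ∫ u, Real.exp (-s * u) ∂condDistrib I Z P (Z ω)) (G (Z ω))
      (Ioi 0 ∩ range ((↑) : ℚ → ℝ)) := by
    rintro _ ⟨hr, r, rfl⟩
    exact hω r hr
  exact heq.of_subset_closure
    ((continuousOn_integral_exp_neg_mul hnonneg).mono Ioi_subset_Ici_self) hGω inter_subset_left
    (Rat.denseRange_cast.open_subset_closure_inter isOpen_Ioi)

end CondDistrib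

section PoissonOrderStatistics

lemma IsOrderable.orderStat_pos {S : Set ℕ} {Y : ℕ → ℝ} (H : IsOrderable S Y)
    (h0 : pointMeasure S Y (Iic 0) = 0) {n : ℕ} (hn : 1 ≤ n) : 0 < orderStat S Y n := by
  rw [← not_le, H.orderStat_le_iff hn, h0, nonpos_iff_eq_zero, Nat.cast_eq_zero]
  lia

namespace IsPoissonRandomMeasure

variable {P : Measure Ω} {A : Ω → Set ℕ} {Y : ℕ → Ω → ℝ}

lemma ae_apply_lt_top [IsProbabilityMeasure P] {Λ : Measure E} {N : Ω → Measure E}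
    (hN : IsPoissonRandomMeasure P Λ N) {B : Set E} (hB : MeasurableSet B) (hΛ : Λ B ≠ ∞) :
    ∀ᵐ ω ∂P, N ω B < ∞ := by
  simpa using (hN.restrict hB).ae_lintegral_lt_top measurable_one (fun _ => ENNReal.one_ne_top)
    (ne_top_of_le_ne_top hΛ ((lintegral_one_sub_expNeg_le _ _).trans_eq (by simp)))

variable {Λ : Measure ℝ} (hN : IsPoissonRandomMeasure P Λ fun ω => pointMeasure (A ω) (Y · ω))
include hN

lemma ae_isOrderable [IsProbabilityMeasure P] [SigmaFinite Λ] [NullSingletonClass Λ]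
    (huniv : Λ univ = ∞) (hIic : ∀ t, Λ (Iic t) < ∞) : ∀ᵐ ω ∂P, IsOrderable (A ω) (Y · ω) := by
  have hfinite := ae_all_iff.2 fun k : ℕ => hN.ae_apply_lt_top measurableSet_Iic (hIic k).ne
  filter_upwards [hN.ae_apply_eq_top .univ huniv, hN.ae_forall_singleton_le_one, hfinite]
    with ω hinfinite hatom hfin
  refine .of_pointMeasure hinfinite hatom fun t => ?_
  obtain ⟨k, hk⟩ := exists_nat_ge t
  exact (measure_mono (Iic_subset_Iic.2 hk)).trans_lt (hfin k)

variable (hord : ∀ᵐ ω ∂P, IsOrderable (A ω) (Y · ω)) {n : ℕ} (hn : 1 ≤ n)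
include hord hn

lemma aemeasurable_orderStat : AEMeasurable (fun ω => orderStat (A ω) (Y · ω) n) P := by
  refine NullMeasurable.aemeasurable (measurable_of_Iic (δ := NullMeasurableSpace Ω P) fun t => ?_)
  refine NullMeasurableSet.congr (s := {ω | (n : ℝ≥0∞) ≤ pointMeasure (A ω) (Y · ω) (Iic t)})
    (measurableSet_le measurable_const
      (hN.measurable_apply measurableSet_Iic)).nullMeasurableSet ?_
  filter_upwards [hord] with ω hω
  exact propext (hω.orderStat_le_iff hn t).symm

lemma setLIntegral_expNeg_tsum_orderStat [IsProbabilityMeasure P] {f : ℝ → ℝ≥0∞}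
    (hf : Measurable f) {B : Set ℝ} (hB : MeasurableSet B) :
    ∫⁻ ω in (fun ω => orderStat (A ω) (Y · ω) n) ⁻¹' B,
        expNeg (∑' k, f (orderStat (A ω) (Y · ω) (n + 1 + k))) ∂P =
      ∫⁻ ω in (fun ω => orderStat (A ω) (Y · ω) n) ⁻¹' B,
        expNeg (∫⁻ y in Ioi (orderStat (A ω) (Y · ω) n), 1 - expNeg (f y) ∂Λ) ∂P := by
  have hZ := hN.aemeasurable_orderStat hord hn
  have hmk := hZ.ae_eq_mk
  have hle (a : ℝ) : hZ.mk _ ⁻¹' Iic a =ᵐ[P]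
      {ω | (n : ℝ≥0∞) ≤ pointMeasure (A ω) (Y · ω) (Iic a)} := by
    filter_upwards [hmk, hord] with ω hω H
    have hiff := H.orderStat_le_iff hn a
    rw [hω] at hiff
    exact propext hiff
  have hpreimage : (fun ω => orderStat (A ω) (Y · ω) n) ⁻¹' B =ᵐ[P] hZ.mk _ ⁻¹' B := by
    filter_upwards [hmk] with ω hω
    exact congrArg (· ∈ B) hω
  rw [setLIntegral_congr hpreimage, setLIntegral_congr hpreimage]
  calc _ = ∫⁻ ω in hZ.mk _ ⁻¹' B,
        expNeg (∫⁻ y in Ioi (hZ.mk _ ω), f y ∂pointMeasure (A ω) (Y · ω)) ∂P := by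
        refine lintegral_congr_ae (ae_restrict_of_ae ?_)
        filter_upwards [hmk, hord] with ω hω H
        rw [← hω, H.setLIntegral_Ioi_orderStat hn hf]
    _ = _ := hN.setLIntegral_expNeg_setLIntegral_Ioi hZ.measurable_mk hle hf hB
    _ = _ := by
        refine lintegral_congr_ae (ae_restrict_of_ae ?_)
        filter_upwards [hmk] with ω hω
        rw [← hω]

end IsPoissonRandomMeasure

end PoissonOrderStatistics

section PowerOrderStatistics

variable {α κ : ℝ}

lemma setLIntegral_Ioi_one_sub_expNeg_powerIntensity (hα : 2 < α) (hκ : 0 ≤ κ) {s t : ℝ}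
    (hs : 0 < s) (ht : 0 < t) :
    ∫⁻ y in Ioi t, 1 - expNeg (.ofReal (s / y)) ∂powerIntensity (2 / α) κ =
      .ofReal (-(κ * q α t s)) := by
  have hintegrand : ∀ y ∈ Ioi t,
      ENNReal.ofReal (κ * y ^ (2 / α - 1)) * (1 - expNeg (.ofReal (s / y))) =
        .ofReal κ * .ofReal ((1 - Real.exp (-(s / y))) * y ^ (2 / α - 1)) := by
    intro y hy
    have hy0 : 0 < y := ht.trans hy
    rw [expNeg_ofReal (by positivity), ← ENNReal.ofReal_one,
      ← ENNReal.ofReal_sub _ (Real.exp_pos _).le, ← ENNReal.ofReal_mul (by positivity),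
      ← ENNReal.ofReal_mul hκ]
    ring_nf
  have hmeas : Measurable fun y : ℝ => 1 - expNeg (.ofReal (s / y)) := by fun_prop
  rw [lintegral_powerIntensity hmeas measurableSet_Ioi, Ioi_inter_Ioi, sup_eq_left.2 ht.le,
    setLIntegral_congr_fun measurableSet_Ioi hintegrand, lintegral_const_mul _ (by fun_prop),
    lintegral_Ioi_one_sub_exp_mul_rpow hα hs ht, ← ENNReal.ofReal_mul hκ, mul_neg]

lemma lintegral_one_sub_expNeg_powerIntensity_ne_top (hα : 2 < α) (hκ : 0 ≤ κ) {s : ℝ}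
    (hs : 0 < s) : ∫⁻ y, 1 - expNeg (.ofReal (s / y)) ∂powerIntensity (2 / α) κ ≠ ∞ := by
  rw [← lintegral_add_compl _ (measurableSet_Iic (a := 1)), compl_Iic,
    setLIntegral_Ioi_one_sub_expNeg_powerIntensity hα hκ hs one_pos]
  have hIic : ∫⁻ y in Iic 1, 1 - expNeg (.ofReal (s / y)) ∂powerIntensity (2 / α) κ ≤
      powerIntensity (2 / α) κ (Iic 1) :=
    (lintegral_one_sub_expNeg_le _ _).trans_eq (by simp)
  exact ENNReal.add_ne_top.2
    ⟨(hIic.trans_lt (powerIntensity_Iic_lt_top (by positivity) hκ 1)).ne, ENNReal.ofReal_ne_top⟩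

namespace IsPoissonRandomMeasure

variable {P : Measure Ω} [IsProbabilityMeasure P] {A : Ω → Set ℕ} {Y : ℕ → Ω → ℝ}
  (hN : IsPoissonRandomMeasure P (powerIntensity (2 / α) κ) fun ω => pointMeasure (A ω) (Y · ω))
  (hα : 2 < α) (hκ : 0 < κ)
include hN hα hκ

lemma ae_isOrderable_of_powerIntensity : ∀ᵐ ω ∂P, IsOrderable (A ω) (Y · ω) :=
  hN.ae_isOrderable (powerIntensity_univ (by positivity) hκ)
    (powerIntensity_Iic_lt_top (by positivity) hκ.le)

lemma ae_forall_orderStat_pos :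
    ∀ᵐ ω ∂P, ∀ n, 1 ≤ n → 0 < orderStat (A ω) (Y · ω) n := by
  filter_upwards [hN.ae_isOrderable_of_powerIntensity hα hκ,
    hN.ae_apply_eq_zero measurableSet_Iic powerIntensity_Iic_zero] with ω H h0 n hn
  exact H.orderStat_pos h0 hn

variable {n : ℕ} (hn : 1 ≤ n)
include hn

lemma ae_summable_inv_orderStat :
    ∀ᵐ ω ∂P, Summable fun k => (orderStat (A ω) (Y · ω) (n + 1 + k))⁻¹ := by
  filter_upwards [hN.ae_lintegral_lt_top (f := fun y => .ofReal (1 / y)) (by fun_prop)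
      (fun _ => ENNReal.ofReal_ne_top)
      (lintegral_one_sub_expNeg_powerIntensity_ne_top hα hκ.le one_pos),
    hN.ae_isOrderable_of_powerIntensity hα hκ, hN.ae_forall_orderStat_pos hα hκ]
    with ω hfinite H hpos
  have htail : ∑' k, ENNReal.ofReal (1 / orderStat (A ω) (Y · ω) (n + 1 + k)) ≠ ∞ := by
    rw [← H.setLIntegral_Ioi_orderStat hn (f := fun y => .ofReal (1 / y)) (by fun_prop)]
    exact ((setLIntegral_le_lintegral _ _).trans_lt hfinite).ne
  refine (ENNReal.summable_toReal htail).congr fun k => ?_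
  rw [one_div, ENNReal.toReal_ofReal (inv_nonneg.2 (hpos _ (by lia)).le)]

lemma ae_ofReal_exp_neg_mul_tsum_inv_orderStat {s : ℝ} (hs : 0 ≤ s) :
    ∀ᵐ ω ∂P, ENNReal.ofReal (Real.exp (-s * ∑' k, (orderStat (A ω) (Y · ω) (n + 1 + k))⁻¹)) =
      expNeg (∑' k, .ofReal (s / orderStat (A ω) (Y · ω) (n + 1 + k))) := by
  filter_upwards [hN.ae_forall_orderStat_pos hα hκ, hN.ae_summable_inv_orderStat hα hκ hn]
    with ω hpos hsum
  have hterm (k : ℕ) : 0 ≤ s * (orderStat (A ω) (Y · ω) (n + 1 + k))⁻¹ :=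
    mul_nonneg hs (inv_nonneg.2 (hpos _ (by lia)).le)
  simp_rw [div_eq_mul_inv]
  rw [← ENNReal.ofReal_tsum_of_nonneg hterm (hsum.mul_left s), expNeg_ofReal (tsum_nonneg hterm),
    tsum_mul_left, neg_mul]

lemma ae_integral_exp_condDistrib_tsum_inv_orderStat :
    ∀ᵐ ω ∂P, ∀ s, 0 < s →
      ∫ u, Real.exp (-s * u) ∂condDistrib (fun ω => ∑' k, (orderStat (A ω) (Y · ω) (n + 1 + k))⁻¹)
          (fun ω => orderStat (A ω) (Y · ω) n) P (orderStat (A ω) (Y · ω) n) =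
        Real.exp (κ * q α (orderStat (A ω) (Y · ω) n) s) := by
  have hord := hN.ae_isOrderable_of_powerIntensity hα hκ
  have hpos := hN.ae_forall_orderStat_pos hα hκ
  have hZ := hN.aemeasurable_orderStat hord hn
  have hI : AEMeasurable (fun ω => ∑' k, (orderStat (A ω) (Y · ω) (n + 1 + k))⁻¹) P :=
    AEMeasurable.tsum fun k => (hN.aemeasurable_orderStat hord (by lia)).inv
  refine ae_forall_integral_exp_condDistrib_eq (G := fun t s => Real.exp (κ * q α t s)) hZ hI
    (hpos.mono fun ω hω => tsum_nonneg fun k => inv_nonneg.2 (hω _ (by lia)).le)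
    (hpos.mono fun ω hω s hs => ((continuousAt_q hs (hω n hn)).const_mul κ).rexp
      |>.continuousWithinAt) fun s hs => ?_
  let g (t : ℝ) : ℝ≥0∞ :=
    expNeg (∫⁻ y in Ioi t, 1 - expNeg (.ofReal (s / y)) ∂powerIntensity (2 / α) κ)
  have hg : Measurable g := measurable_expNeg.comp <| Antitone.measurable fun _ _ htu =>
    lintegral_mono_set (Ioi_subset_Ioi htu)
  have hlaplace := ae_lintegral_condDistrib_eq hZ hI
    (ψ := fun u => .ofReal (Real.exp (-s * u))) (by fun_prop) hg fun B hB => by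
      rw [← hN.setLIntegral_expNeg_tsum_orderStat hord hn (f := fun y => .ofReal (s / y))
        (by fun_prop) hB]
      exact lintegral_congr_ae (ae_restrict_of_ae
        (hN.ae_ofReal_exp_neg_mul_tsum_inv_orderStat hα hκ hn hs.le))
  filter_upwards [hpos, hlaplace] with ω hω hω_laplace
  have hZpos := hω n hn
  rw [integral_eq_lintegral_of_nonneg_ae (ae_of_all _ fun _ => (Real.exp_pos _).le)
    (by fun_prop), hω_laplace]
  simp only [g]
  rw [setLIntegral_Ioi_one_sub_expNeg_powerIntensity hα hκ.le hs hZpos,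
    expNeg_ofReal (neg_nonneg.2 (mul_nonpos_of_nonneg_of_nonpos hκ.le (q_nonpos hα hs hZpos))),
    neg_neg, ENNReal.toReal_ofReal (Real.exp_pos _).le]

end IsPoissonRandomMeasure

end PowerOrderStatistics

section Network

lemma integral_rpow_pos {ν : Measure ℝ} [NeZero ν] {p : ℝ} (h_pos : ∀ᵐ t ∂ν, 0 < t)
    (h_mom : Integrable (fun t => t ^ p) ν) : 0 < ∫ t, t ^ p ∂ν := by
  have hpow : ∀ᵐ t ∂ν, 0 < t ^ p := h_pos.mono fun t ht => Real.rpow_pos_of_pos ht p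
  rw [integral_pos_iff_support_of_nonneg_ae (hpow.mono fun _ => le_of_lt) h_mom]
  exact (NeZero.pos (ν univ)).trans_le (measure_mono_ae (hpow.mono fun _ ht _ => ht.ne'))

lemma isPoissonRandomMeasure_inversePower {P : Measure Ω} [IsProbabilityMeasure P]
    {lam α φ : ℝ} (hlam : 0 ≤ lam) (hα : 0 < α) (hφ0 : 0 ≤ φ) (hφ1 : φ ≤ 2 * Real.pi) (x : Plane)
    {X : ℕ → Ω → Plane} (hX : IsPoissonPointProcess P (ENNReal.ofReal lam • volume) X)
    {ν : Measure ℝ} {h : ℕ → Ω → ℝ} (h_meas : ∀ i, Measurable (h i))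
    (h_law : ∀ i, P.map (h i) = ν) (h_pos : ∀ᵐ t ∂ν, 0 < t) (h_indep : iIndepFun h P)
    (hX_indep : IndepFun (fun ω i => X i ω) (fun ω i => h i ω) P)
    (h_mom : Integrable (fun t : ℝ => t ^ (2 / α)) ν) :
    IsPoissonRandomMeasure P (powerIntensity (2 / α) (φ * lam / α * ∫ t, t ^ (2 / α) ∂ν))
      fun ω => pointMeasure (interferers x φ X ω) (inversePower x α X h · ω) := by
  have : IsProbabilityMeasure ν :=
    h_law 0 ▸ Measure.isProbabilityMeasure_map (h_meas 0).aemeasurable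
  have : SigmaFinite (ENNReal.ofReal lam • volume : Measure Plane) :=
    inferInstanceAs (SigmaFinite (lam.toNNReal • volume))
  have hsector : MeasurableSet {p : Plane × ℝ | polarAngle (p.1 - x) ≤ φ} :=
    measurableSet_le (by fun_prop) measurable_const
  have hpower : Measurable fun p : Plane × ℝ => ‖p.1 - x‖ ^ α / p.2 := by fun_prop
  rw [← map_inversePower x hlam hα hφ0 hφ1 ν h_pos h_mom]
  convert ((hX.isPoissonRandomMeasure_marked h_meas h_law h_indep hX_indep).restrict
    hsector).map hpower using 2 with ω
  rw [map_restrict_pointMeasure _ _ hsector hpower]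
  simp only [mem_univ, true_and]
  rfl

end Network

end PoissonNetwork

end

theorem theorem2 {Ω : Type*} [MeasurableSpace Ω] (P : Measure Ω) [IsProbabilityMeasure P]
    (lam α φ : ℝ) (hlam : 0 < lam) (hα : 2 < α) (hφ0 : 0 < φ) (hφ1 : φ ≤ 2 * Real.pi)
    -- the receiver
    (x : PoissonNetwork.Plane)
    -- the nodes: a homogeneous Poisson point process of intensity `lam`
    (X : ℕ → Ω → PoissonNetwork.Plane)
    (hX : PoissonNetwork.IsPoissonPointProcess P (ENNReal.ofReal lam • volume) X)
    -- the channel gains: positive, i.i.d. with law `ν`, independent of the nodes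
    (ν : Measure ℝ) (h : ℕ → Ω → ℝ)
    (h_meas : ∀ i, Measurable (h i))
    (h_law : ∀ i, P.map (h i) = ν)
    (h_pos : ∀ᵐ t ∂ν, 0 < t)
    (h_indep : iIndepFun h P)
    (hX_indep : IndepFun (fun ω i => X i ω) (fun ω i => h i ω) P)
    (h_mom : Integrable (fun t : ℝ => t ^ (2 / α)) ν)
    (n : ℕ) (hn : 1 ≤ n) :
    -- almost surely `z 1 < z 2 < …` enumerates all the inverse powers of the interferers,
    (∀ᵐ ω ∂P, StrictMono (fun k : ℕ => PoissonNetwork.z x φ α X h (k + 1) ω) ∧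
      Set.range (fun k : ℕ => PoissonNetwork.z x φ α X h (k + 1) ω) =
        PoissonNetwork.powerPoints x φ α X h ω) ∧
    -- the series defining the partial accumulative interference converges,
    (∀ᵐ ω ∂P, Summable (fun k : ℕ => (PoissonNetwork.z x φ α X h (n + 1 + k) ω)⁻¹)) ∧
    -- and its conditional law given `z n` has the stated Laplace transform
    (∀ᵐ ω ∂P, ∀ s : ℝ, 0 < s →
      ∫ u, Real.exp (-s * u) ∂(condDistrib (PoissonNetwork.partialInterference x φ α X h n)
          (PoissonNetwork.z x φ α X h n) P (PoissonNetwork.z x φ α X h n ω)) =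
        Real.exp (φ * lam / α * (∫ t, t ^ (2 / α) ∂ν) *
          PoissonNetwork.q α (PoissonNetwork.z x φ α X h n ω) s)) := by
  have hα0 : 0 < α := two_pos.trans hα
  have : IsProbabilityMeasure ν :=
    h_law 0 ▸ Measure.isProbabilityMeasure_map (h_meas 0).aemeasurable
  have hκ : 0 < φ * lam / α * ∫ t, t ^ (2 / α) ∂ν :=
    mul_pos (by positivity) (PoissonNetwork.integral_rpow_pos h_pos h_mom)
  have hN := PoissonNetwork.isPoissonRandomMeasure_inversePower hlam.le hα0 hφ0.le hφ1 x hX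
    h_meas h_law h_pos h_indep hX_indep h_mom
  exact ⟨(hN.ae_isOrderable_of_powerIntensity hα hκ).mono fun ω hω =>
      hω.strictMono_orderStat_and_range_eq,
    hN.ae_summable_inv_orderStat hα hκ hn,
    hN.ae_integral_exp_condDistrib_tsum_inv_orderStat hα hκ hn⟩
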